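/- An approval election $E=(C,V)$ consists of a finite set $C$ of $m$ candidates and a list $V=(v_1,\dots,v_n)$ of voters, where each voter $v$ approves a subset $A(v)\subseteq C$. The approval score of a candidate $c$ is $\mathrm{app}_E(c)=|\{v\in V : c\in A(v)\}|$. For a committee size $k\in\{1,\dots,m\}$, Approval Voting (AV) selects the family $\mathrm{AV}(E,k)$ of all $k$-element sets $S\subseteq C$ that maximize $\sum_{c\in S}\mathrm{app}_E(c)$ among all $k$-element subsets of $C$. There are three types of operations on an election. Add: a candidate $c\notin A(v)$ is added to $A(v)$ for some voter $v$. Remove: a candidate $c\in A(v)$ is removed from $A(v)$ for some voter $v$. Swap: for some voter $v$ and candidates $c\in A(v)$, $d\notin A(v)$, the set $A(v)$ is replaced by $(A(v)\setminus\{c\})\cup\{d\}$. For $\mathrm{Op}\in\{\mathrm{Add},\mathrm{Remove},\mathrm{Swap}\}$, the problem AV-Op-Robustness-Radius is the following decision problem. Given an approval election $E=(C,V)$ (listed explicitly, i.e. one mark for each candidate and, for each voter, one bit for each candidate), a committee size $k\in\{1,\dots,|C|\}$ and an integer $B\ge 0$ (both in binary), decide whether some sequence of at most $B$ operations of type $\mathrm{Op}$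 transforms $E$ into an election $E'$ with $\mathrm{AV}(E,k)\ne\mathrm{AV}(E',k)$. **Theorem.** For each $\mathrm{Op}\in\{\mathrm{Add},\mathrm{Remove},\mathrm{Swap}\}$, the problem AV-Op-Robustness-Radius is in P; that is, the language of the encodings of its yes-instances is decided by a deterministic Turing machine in time polynomial in the length of the input word. -/

import Mathlib

namespace ApprovalVoting

/-! ### Approval elections and Approval Voting -/

/-- An approval-based election with candidates `Fin m` and voters `Fin n`:
`E v` is the set of the candidates that voter `v` approves. -/
abbrev Election (m n : ℕ) : Type := Fin n → Finset (Fin m)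

/-- An approval-based multiwinner voting rule: given an election and a committee size `k`, it
provides the family of the (size-`k`) committees that tie for victory. -/
abbrev MultiwinnerRule : Type := ∀ m n : ℕ, Election m n → ℕ → Set (Finset (Fin m))

/-- The approval score of candidate `c`: the number of the voters that approve `c`. -/
def approvalScore {m n : ℕ} (E : Election m n) (c : Fin m) : ℕ :=
  (Finset.univ.filter fun v : Fin n => c ∈ E v).card

/-- The AV score of a committee: the sum of the approval scores of its members. -/
def avScore {m n : ℕ} (E : Election m n) (S : Finset (Fin m)) : ℕ :=
  ∑ c ∈ S, approvalScore E c

/-- The Approval Voting rule selects all the size-`k` committees with the highest AV score. -/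
def AV : MultiwinnerRule := fun _ _ E k =>
  {S | S.card = k ∧ ∀ T, T.card = k → avScore E T ≤ avScore E S}

/-! ### Operations on approvals -/

/-- The three types of operations: adding an approval, removing an approval, and moving an
approval from one candidate to another one within a vote. -/
inductive Op
  | add
  | remove
  | swap

/-- `op.Step E E'`: the election `E'` is obtained from `E` by a single operation of type `op`. -/
def Op.Step {m n : ℕ} : Op → Election m n → Election m n → Prop
  | .add, E, E' => ∃ v c, c ∉ E v ∧ E' = Function.update E v (insert c (E v))
  | .remove, E, E' => ∃ v c, c ∈ E v ∧ E' = Function.update E v ((E v).erase c)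
  | .swap, E, E' => ∃ v c d, c ∈ E v ∧ d ∉ E v ∧
      E' = Function.update E v (insert d ((E v).erase c))

/-- `op.Steps t E E'`: the election `E'` is obtained from `E` by a sequence of exactly `t`
operations of type `op`. -/
inductive Op.Steps {m n : ℕ} (op : Op) : ℕ → Election m n → Election m n → Prop
  | refl (E : Election m n) : Op.Steps op 0 E E
  | tail {t : ℕ} {E F G : Election m n} :
      Op.Steps op t E F → op.Step F G → Op.Steps op (t + 1) E G

/-! ### The robustness radius problem -/

/-- An instance of the robustness radius problem: an election with `m` candidates and `n` voters,
a committee size `k` with `1 ≤ k ≤ m`, and a number `B` of operations. -/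
structure Instance where
  m : ℕ
  n : ℕ
  E : Election m n
  k : ℕ
  one_le_k : 1 ≤ k
  k_le_m : k ≤ m
  B : ℕ

/-- The answer is "yes" if the result of rule `R` can be changed by applying a sequence of
operations of type `op` whose length is within the budget `B`. -/
def Instance.IsYes (R : MultiwinnerRule) (op : Op) (I : Instance) : Prop :=
  ∃ t ≤ I.B, ∃ E' : Election I.m I.n, op.Steps t I.E E' ∧ R I.m I.n I.E I.k ≠ R I.m I.n E' I.k

open Computability in
/-- The word that encodes a vote: one bit for each candidate, and a closing comma. -/
def encodeVote {m : ℕ} (A : Finset (Fin m)) : List Γ' :=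
  List.ofFn (fun c : Fin m => Γ'.bit (decide (c ∈ A))) ++ [Γ'.comma]

open Computability in
/-- The word that encodes an instance: one mark for each candidate, then `k` and `B` in binary,
then the votes, one after another. -/
def Instance.encode (I : Instance) : List Γ' :=
  List.replicate I.m (Γ'.bit true) ++ Γ'.comma ::
    (encodingNatΓ'.encode I.k ++ Γ'.comma ::
      (encodingNatΓ'.encode I.B ++ Γ'.comma ::
        (List.ofFn fun v : Fin I.n => encodeVote (I.E v)).flatten))

/-- The problem `R`-`op`-Robustness-Radius as a language: the encodings of the yes-instances. -/
def robustnessRadius (R : MultiwinnerRule) (op : Op) : Language Computability.Γ' :=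
  {w | ∃ I : Instance, I.encode = w ∧ I.IsYes R op}

/-! ### Different instances have different encodings -/

theorem append_comma_inj {x y : List Bool} {s t : List Computability.Γ'}
    (h : x.map Computability.Γ'.bit ++ Computability.Γ'.comma :: s =
      y.map Computability.Γ'.bit ++ Computability.Γ'.comma :: t) : x = y ∧ s = t := by
  induction x generalizing y with
  | nil => cases y <;> simp_all
  | cons a x ih =>
    cases y with
    | nil => simp_all
    | cons b y =>
      simp only [List.map_cons, List.cons_append, List.cons.injEq,
        Computability.Γ'.bit.injEq] at h ⊢
      have := ih h.2
      tauto

theorem encodeVote_eq {m : ℕ} (A : Finset (Fin m)) (s : List Computability.Γ') :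
    encodeVote A ++ s = (List.ofFn fun c : Fin m => decide (c ∈ A)).map Computability.Γ'.bit ++
      Computability.Γ'.comma :: s := by
  simp [encodeVote, List.map_ofFn, Function.comp_def]

theorem encodeVotes_inj {m n n' : ℕ} (E : Election m n) (E' : Election m n')
    (h : (List.ofFn fun v => encodeVote (E v)).flatten =
      (List.ofFn fun v => encodeVote (E' v)).flatten) : List.ofFn E = List.ofFn E' := by
  induction n generalizing n' with
  | zero => cases n' <;> simp_all [encodeVote]
  | succ n ih =>
    cases n' with
    | zero => simp_all [encodeVote]
    | succ n' =>
      simp only [List.ofFn_succ, List.flatten_cons, encodeVote_eq] at h ⊢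
      obtain ⟨h1, h2⟩ := append_comma_inj h
      rw [ih _ _ h2]
      congr 1
      ext c
      have := congrFun (List.ofFn_injective h1) c
      simpa using this

theorem Instance.encode_injective : Function.Injective Instance.encode := by
  rintro ⟨m, n, E, k, h1, h2, B⟩ ⟨m', n', E', k', h1', h2', B'⟩ h
  have key (a : ℕ) : List.replicate a (Computability.Γ'.bit true) =
      (List.replicate a true).map Computability.Γ'.bit := by simp
  have key' (a : ℕ) : Computability.encodingNatΓ'.encode a =
      (Computability.encodeNat a).map Computability.Γ'.bit := rfl
  simp only [Instance.encode, key, key'] at h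
  obtain ⟨hm, hs⟩ := append_comma_inj h
  obtain ⟨hk, ht⟩ := append_comma_inj hs
  obtain ⟨hB, hv⟩ := append_comma_inj ht
  obtain rfl : m = m' := by simpa using congrArg List.length hm
  obtain rfl : k = k' := Computability.encodingNatBool.encode_injective hk
  obtain rfl : B = B' := Computability.encodingNatBool.encode_injective hB
  have hE := encodeVotes_inj E E' hv
  obtain rfl : n = n' := by simpa using congrArg List.length hE
  obtain rfl : E = E' := List.ofFn_injective hE
  rfl

/-! ### Polynomial time -/

open Classical in
/-- The complexity class P: the languages whose membership is decided, on all words, by a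
(multi-stack) Turing machine that outputs the answer within a number of steps that is bounded by
a polynomial in the length of the word. -/
def InP {α : Type} (L : Language α) : Prop :=
  Nonempty (Turing.TM2ComputableInPolyTime (id : List α → List α) Computability.encodeBool
    (fun w => decide (w ∈ L)))

end ApprovalVoting

/-!
The proof has a combinatorial half and a computational half.

*When can the winning committees be changed?* Changing the result of Approval Voting amounts to
closing a gap in the sequence of the scores. With `numAtLeast E t` the number of the candidates
with a score of at least `t`, and `numLevels E x` the number of the thresholds `t` between `1` and
the number of voters with `numAtLeast E t = x`, the number `numLevels E x` is the gap between the
`x`-th and the `(x + 1)`-st highest score. Usually the gap that matters is the one after the `k`-th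
score: closing it creates a tie, and if the gap is zero, then a single operation breaks a tie. For
adding approvals, there is an exception if more than `k` candidates are approved by all voters:
none of them can get ahead of the others, so another candidate has to catch up with them, whence
the relevant gap is the one after `max k (numAtLeast E n)`. For removing approvals, it is
symmetrically the one after `min k (numAtLeast E 1)`. A swap closes a gap by two. The theorems
`add_radius_iff`, `remove_radius_iff` and `swap_radius_iff` state the resulting criteria, which
can be evaluated by counting.

*Polynomial time.* The loop programs `LoopProgram.Prog` act on finitely many counters. Their only
loop runs a body once for each symbol of the fixed input word, so a program whose loops are nested
to depth `d` takes time `O(N ^ d)` on words of length `N` whatever the counters hold, and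
`inP_of_prog` translates it to a Turing machine with one stack for each counter and two stacks for
each nesting level. Numbers are held in unary, so the program `decision` cuts `k` and `B` off at
`N`. This is harmless: the encodings of instances have `k ≤ m < N`, and all gaps are at most the
number of voters, which is less than `N`. The program reads the word, checks that it is the
encoding of an instance, and evaluates the criterion.
-/

/-! ### Loop programs -/

namespace LoopProgram

open Turing

/-- Programs that act on finitely many counters (indexed by `R`) while reading a fixed word over
`α`. Besides incrementing, decrementing (truncated at zero) and testing for zero, the only control
structure is `each`, which runs a body once for every symbol of the word. The index `d` bounds the
nesting depth of the loops. -/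
inductive Prog (α R : Type) : ℕ → Type
  | skip {d : ℕ} : Prog α R d
  | inc {d : ℕ} (i : R) : Prog α R d
  | dec {d : ℕ} (i : R) : Prog α R d
  | ifz {d : ℕ} (i : R) (p q : Prog α R d) : Prog α R d
  | seq {d : ℕ} (p q : Prog α R d) : Prog α R d
  | each {d : ℕ} (p : α → Prog α R d) : Prog α R (d + 1)

namespace Prog

variable {α R : Type} {d : ℕ}

/-- The effect of a program on the counters, for a given input word. -/
def eval [DecidableEq R] (w : List α) : {d : ℕ} → Prog α R d → (R → ℕ) → R → ℕ
  | _, skip, s => s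
  | _, inc i, s => Function.update s i (s i + 1)
  | _, dec i, s => Function.update s i (s i - 1)
  | _, ifz i p q, s => if s i = 0 then p.eval w s else q.eval w s
  | _, seq p q, s => q.eval w (p.eval w s)
  | _, each p, s => w.foldl (fun s a => (p a).eval w s) s

/-- A bound for the running time of a program, in terms of the length of the word alone. -/
noncomputable def time [Fintype α] : {d : ℕ} → Prog α R d → Polynomial ℕ
  | _, skip => 1
  | _, inc _ => 1
  | _, dec _ => 1
  | _, ifz _ p q => p.time + q.time + 1
  | _, seq p q => p.time + q.time
  | _, each p => Polynomial.X * (∑ a, (p a).time + 2) + 2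

/-- The labels of the machine code of a program. The labels `false` and `true` of a loop stand for
rewinding the word and for reading its next symbol. -/
def Label : {d : ℕ} → Prog α R d → Type
  | _, skip => Unit
  | _, inc _ => Unit
  | _, dec _ => Unit
  | _, ifz _ p q => Option (p.Label ⊕ q.Label)
  | _, seq p q => p.Label ⊕ q.Label
  | _, each p => Bool ⊕ (Σ a, (p a).Label)

/-- The label at which the machine code of a program starts. -/
def entry : {d : ℕ} → (p : Prog α R d) → p.Label
  | _, skip => ()
  | _, inc _ => ()
  | _, dec _ => ()
  | _, ifz _ _ _ => none
  | _, seq p _ => Sum.inl p.entry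
  | _, each _ => Sum.inl false

theorem finite_label [Finite α] (p : Prog α R d) : Finite p.Label := by
  induction p with
  | skip | inc | dec => exact inferInstanceAs (Finite Unit)
  | ifz i p q hp hq => exact inferInstanceAs (Finite (Option (p.Label ⊕ q.Label)))
  | seq p q hp hq => exact inferInstanceAs (Finite (p.Label ⊕ q.Label))
  | each p hp => exact inferInstanceAs (Finite (Bool ⊕ (Σ a, (p a).Label)))

/-- A counter grows by at most one in each step. This bounds the time for clearing the stacks. -/
theorem eval_le_add_time [DecidableEq R] [Fintype α] (w : List α) (p : Prog α R d) (s : R → ℕ)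
    (i : R) : p.eval w s i ≤ s i + p.time.eval w.length := by
  induction p generalizing s with
  | skip => simp [eval]
  | inc j =>
    simp only [eval, time, Function.update_apply]
    split <;> simp_all
  | dec j =>
    simp only [eval, time, Function.update_apply]
    split <;> simp_all; omega
  | ifz j p q hp hq =>
    have := hp s
    have := hq s
    simp only [eval, time, Polynomial.eval_add]
    split <;> omega
  | seq p q hp hq =>
    have h1 := hp s
    have h2 := hq (p.eval w s)
    simp only [eval, time, Polynomial.eval_add]
    omega
  | each p hp =>
    have key (u : List α) (s : R → ℕ) :
        u.foldl (fun s a => (p a).eval w s) s i ≤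
          s i + u.length * (∑ a, (p a).time).eval w.length := by
      induction u generalizing s with
      | nil => simp
      | cons a u ih =>
        have h1 := ih ((p a).eval w s)
        have h2 := hp a s
        have h3 : (p a).time.eval w.length ≤ (∑ a, (p a).time).eval w.length := by
          rw [Polynomial.eval_finsetSum]
          exact Finset.single_le_sum (f := fun a => (p a).time.eval w.length)
            (fun _ _ => Nat.zero_le _) (Finset.mem_univ a)
        simp only [List.foldl_cons, List.length_cons, add_mul, one_mul]
        omega
    refine (key w s).trans ?_
    simp only [time, Polynomial.eval_add, Polynomial.eval_mul, Polynomial.eval_X, mul_add]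
    omega

end Prog

/-! ### Compilation to multi-stack Turing machines -/

/-- The working stacks: the input, a unary stack for each counter, and, for each level of loop
nesting, two stacks that hold a copy of the word, cut at the position that the loop has reached:
the symbols before that position (in reverse) and those after it. -/
inductive Stack (R : Type) (D : ℕ)
  | inp
  | reg (i : R)
  | lft (j : Fin D)
  | rgt (j : Fin D)
  deriving DecidableEq, Fintype

/-- The stack alphabets. The additional stack `none` is for the output. -/
abbrev StackAlphabet (α R : Type) (D : ℕ) : Option (Stack R D) → Type
  | none => Bool
  | some _ => α

/-- The contents of all stacks, from those of the output stack and of the working stacks. -/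
def withOutput {α R : Type} {D : ℕ} (o : List Bool) (S : Stack R D → List α) :
    ∀ k, List (StackAlphabet α R D k)
  | none => o
  | some x => S x

theorem update_withOutput_some {α R : Type} [DecidableEq R] {D : ℕ} (o : List Bool)
    (S : Stack R D → List α) (x : Stack R D) (l : List α) :
    Function.update (withOutput o S) (some x) l = withOutput o (Function.update S x l) := by
  funext k
  cases k with
  | none => simp [withOutput]
  | some y =>
    by_cases h : y = x
    · subst h; simp [withOutput]
    · simp [withOutput, h]

theorem update_withOutput_none {α R : Type} [DecidableEq R] {D : ℕ} (o : List Bool)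
    (S : Stack R D → List α) (l : List Bool) :
    Function.update (withOutput o S) none l = withOutput l S := by
  funext k
  cases k <;> simp [withOutput]

/-- The contents of the working stacks after the counters have been set to `s`. -/
def withCounters {α R : Type} [Inhabited α] {D : ℕ} (S : Stack R D → List α) (s : R → ℕ) :
    Stack R D → List α
  | .reg i => List.replicate (s i) default
  | x => S x

section Reach

variable {K Λ σ : Type} [DecidableEq K] {Γ : K → Type}

/-- The machine gets from one configuration to another one within `t` steps. -/
def ReachesIn (M : Λ → TM2.Stmt Γ Λ σ) (t : ℕ) (c c' : TM2.Cfg Γ Λ σ) : Prop :=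
  Nonempty (StateTransition.EvalsToInTime (TM2.step M) c (some c') t)

variable {M : Λ → TM2.Stmt Γ Λ σ}

theorem ReachesIn.trans {t u : ℕ} {a b c : TM2.Cfg Γ Λ σ} (h : ReachesIn M t a b)
    (h' : ReachesIn M u b c) : ReachesIn M (t + u) a c :=
  ⟨add_comm u t ▸ .trans _ _ _ _ _ _ h.some h'.some⟩

theorem ReachesIn.mono {t u : ℕ} {a b : TM2.Cfg Γ Λ σ} (h : ReachesIn M t a b) (htu : t ≤ u) :
    ReachesIn M u a b :=
  ⟨⟨h.some.toEvalsTo, h.some.steps_le_m.trans htu⟩⟩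

theorem ReachesIn.single {a b : TM2.Cfg Γ Λ σ} (h : TM2.step M a = some b) : ReachesIn M 1 a b :=
  ⟨⟨⟨1, h⟩, le_rfl⟩⟩

end Reach

section Compile

variable {α R Λ : Type} [DecidableEq R] [Inhabited α] {D : ℕ}

open Prog TM2.Stmt

/-- The machine code of a program, as a part of a machine with labels `Λ` whose state remembers
the symbol that was read last; `emb` places the labels of the code, and the code ends by jumping
to `exit`. -/
def code : {d : ℕ} → d ≤ D → (p : Prog α R d) → (p.Label → Λ) → Λ → p.Label →
    TM2.Stmt (StackAlphabet α R D) Λ (Option α)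
  | _, _, skip, _, exit => fun _ => goto fun _ => exit
  | _, _, inc i, _, exit => fun _ => push (some (.reg i)) (fun _ => default) (goto fun _ => exit)
  | _, _, dec i, _, exit => fun _ => pop (some (.reg i)) (fun _ a => a) (goto fun _ => exit)
  | _, h, ifz i p q, emb, exit => fun l : Option (p.Label ⊕ q.Label) =>
    match l with
    | none => peek (some (.reg i)) (fun _ a => a) (branch Option.isSome
        (goto fun _ => emb (some (Sum.inr q.entry))) (goto fun _ => emb (some (Sum.inl p.entry))))
    | some (Sum.inl l) => code h p (fun l => emb (some (Sum.inl l))) exit l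
    | some (Sum.inr l) => code h q (fun l => emb (some (Sum.inr l))) exit l
  | _, h, seq p q, emb, exit => fun l : p.Label ⊕ q.Label =>
    match l with
    | Sum.inl l => code h p (fun l => emb (Sum.inl l)) (emb (Sum.inr q.entry)) l
    | Sum.inr l => code h q (fun l => emb (Sum.inr l)) exit l
  | d + 1, h, each p, emb, exit => fun l : Bool ⊕ (Σ a, (p a).Label) =>
    match l with
    | Sum.inl false => pop (some (.lft ⟨d, h⟩)) (fun _ a => a) (branch Option.isSome
        (push (some (.rgt ⟨d, h⟩)) (fun v => v.getD default) (goto fun _ => emb (Sum.inl false)))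
        (goto fun _ => emb (Sum.inl true)))
    | Sum.inl true => pop (some (.rgt ⟨d, h⟩)) (fun _ a => a) (branch Option.isSome
        (push (some (.lft ⟨d, h⟩)) (fun v => v.getD default)
          (goto fun v => emb (Sum.inr ⟨v.getD default, (p _).entry⟩)))
        (goto fun _ => exit))
    | Sum.inr ⟨a, l⟩ =>
      code (Nat.le_of_succ_le h) (p a) (fun l => emb (Sum.inr ⟨a, l⟩)) (emb (Sum.inl true)) l

theorem withCounters_update_lft (S : Stack R D → List α) (s : R → ℕ) (j : Fin D) (l : List α) :
    Function.update (withCounters S s) (.lft j) l =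
      withCounters (Function.update S (.lft j) l) s := by
  funext x
  cases x <;> simp [withCounters, Function.update_apply]

theorem withCounters_update_rgt (S : Stack R D → List α) (s : R → ℕ) (j : Fin D) (l : List α) :
    Function.update (withCounters S s) (.rgt j) l =
      withCounters (Function.update S (.rgt j) l) s := by
  funext x
  cases x <;> simp [withCounters, Function.update_apply]

theorem withCounters_update_reg (S : Stack R D → List α) (s : R → ℕ) (i : R) (c : ℕ) :
    Function.update (withCounters S s) (.reg i) (List.replicate c default) =
      withCounters S (Function.update s i c) := by
  funext x
  cases x with
  | reg j => by_cases h : j = i <;> simp [withCounters, h]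
  | _ => simp [withCounters]

/-- The machine code of a program has the effect of the program, provided that the copies of the
word for its loops are there, and it obeys the time bound. -/
theorem reachesIn_code [Fintype α] {M : Λ → TM2.Stmt (StackAlphabet α R D) Λ (Option α)}
    (w : List α) (o : List Bool) {d : ℕ} (hd : d ≤ D) (p : Prog α R d) (emb : p.Label → Λ)
    (exit : Λ) (hM : ∀ l, M (emb l) = code hd p emb exit l) (S : Stack R D → List α)
    (hl : ∀ j : Fin D, j < d → S (.lft j) = w.reverse)
    (hr : ∀ j : Fin D, j < d → S (.rgt j) = []) (s : R → ℕ) (v : Option α) :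
    ∃ v', ReachesIn M (p.time.eval w.length)
      ⟨some (emb p.entry), v, withOutput o (withCounters S s)⟩
      ⟨some exit, v', withOutput o (withCounters S (p.eval w s))⟩ := by
  induction p generalizing exit S s v with
  | skip =>
    refine ⟨v, (ReachesIn.single ?_).mono (by simp [time])⟩
    simp only [TM2.step, hM]
    rfl
  | inc i =>
    refine ⟨v, (ReachesIn.single ?_).mono (by simp [time])⟩
    simp only [TM2.step, hM, Prog.eval]
    rw [← withCounters_update_reg, ← update_withOutput_some]
    rfl
  | dec i =>
    refine ⟨(List.replicate (s i) default).head?, (ReachesIn.single ?_).mono (by simp [time])⟩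
    simp only [TM2.step, hM, Prog.eval]
    rw [← withCounters_update_reg, ← List.tail_replicate, ← update_withOutput_some]
    rfl
  | ifz i p q hp hq =>
    have hstep : TM2.step M ⟨some (emb none), v, withOutput o (withCounters S s)⟩ =
        some ⟨some (if s i = 0 then emb (some (Sum.inl p.entry)) else emb (some (Sum.inr q.entry))),
          (List.replicate (s i) default).head?, withOutput o (withCounters S s)⟩ := by
      simp only [TM2.step, hM none]
      cases hs : s i <;> simp [code, withOutput, withCounters, hs, List.replicate_succ]
    by_cases hs : s i = 0
    · obtain ⟨v', h⟩ := hp hd (fun l => emb (some (Sum.inl l))) exit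
        (fun l => hM (some (Sum.inl l))) S hl hr s (List.replicate (s i) default).head?
      refine ⟨v', ((ReachesIn.single hstep).trans ?_).mono (t := 1 + p.time.eval w.length) ?_⟩
      · simpa only [hs, if_true, Prog.eval] using h
      · simp only [time, Polynomial.eval_add, Polynomial.eval_one]; omega
    · obtain ⟨v', h⟩ := hq hd (fun l => emb (some (Sum.inr l))) exit
        (fun l => hM (some (Sum.inr l))) S hl hr s (List.replicate (s i) default).head?
      refine ⟨v', ((ReachesIn.single hstep).trans ?_).mono (t := 1 + q.time.eval w.length) ?_⟩
      · simpa only [hs, if_false, Prog.eval] using h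
      · simp only [time, Polynomial.eval_add, Polynomial.eval_one]; omega
  | seq p q hp hq =>
    obtain ⟨v₁, h₁⟩ := hp hd (fun l => emb (Sum.inl l)) (emb (Sum.inr q.entry))
      (fun l => hM (Sum.inl l)) S hl hr s v
    obtain ⟨v₂, h₂⟩ := hq hd (fun l => emb (Sum.inr l)) exit (fun l => hM (Sum.inr l))
      S hl hr (p.eval w s) v₁
    refine ⟨v₂, (h₁.trans h₂).mono ?_⟩
    simp [time]
  | @each d p hp =>
    -- The contents of the stacks when the copy of the word is cut into `u.reverse` and `u'`.
    let cut (u u' : List α) : Stack R D → List α :=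
      Function.update (Function.update S (.lft ⟨d, hd⟩) u) (.rgt ⟨d, hd⟩) u'
    have hcut : cut w.reverse [] = S := by
      funext x
      simp only [cut, Function.update_apply]
      split
      · subst x; exact (hr ⟨d, hd⟩ (Nat.lt_succ_self d)).symm
      · split
        · subst x; exact (hl ⟨d, hd⟩ (Nat.lt_succ_self d)).symm
        · rfl
    have cut_lft (u u' : List α) : cut u u' (.lft ⟨d, hd⟩) = u := by simp [cut]
    have cut_rgt (u u' : List α) : cut u u' (.rgt ⟨d, hd⟩) = u' := by simp [cut]
    have update_lft (u u' x : List α) :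
        Function.update (cut u u') (.lft ⟨d, hd⟩) x = cut x u' := by
      simp only [cut]
      rw [Function.update_comm (by simp), Function.update_idem]
    have update_rgt (u u' x : List α) :
        Function.update (cut u u') (.rgt ⟨d, hd⟩) x = cut u x := by
      simp only [cut, Function.update_idem]
    -- At the label `false`, the copy of the word is moved back to the stack `rgt`.
    have rewind (u u' : List α) (s : R → ℕ) (v : Option α) : ReachesIn M (u.length + 1)
        ⟨some (emb (Sum.inl false)), v, withOutput o (withCounters (cut u u') s)⟩
        ⟨some (emb (Sum.inl true)), none,
          withOutput o (withCounters (cut [] (u.reverse ++ u')) s)⟩ := by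
      induction u generalizing u' v with
      | nil =>
        refine ReachesIn.single ?_
        simp only [TM2.step, hM (Sum.inl false)]
        simp [code, withOutput, withCounters, update_withOutput_some, withCounters_update_lft,
          cut_lft, update_lft]
      | cons a u ih =>
        rw [List.reverse_cons, List.append_assoc, List.singleton_append, List.length_cons,
          add_comm _ 1]
        refine (ReachesIn.single ?_).trans (ih (a :: u') (some a))
        simp only [TM2.step, hM (Sum.inl false)]
        simp [code, withOutput, withCounters, update_withOutput_some, withCounters_update_lft,
          withCounters_update_rgt, cut_lft, update_lft, cut_rgt, update_rgt]
    -- At the label `true`, the body is executed for each symbol of `u'`.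
    have loop (u' u : List α) (s : R → ℕ) (v : Option α) : ReachesIn M
        (u'.length * ((∑ a, (p a).time).eval w.length + 1) + 1)
        ⟨some (emb (Sum.inl true)), v, withOutput o (withCounters (cut u u') s)⟩
        ⟨some exit, none, withOutput o (withCounters (cut (u'.reverse ++ u) [])
          (u'.foldl (fun s a => (p a).eval w s) s))⟩ := by
      induction u' generalizing u s v with
      | nil =>
        rw [List.length_nil, zero_mul]
        refine ReachesIn.single ?_
        simp only [TM2.step, hM (Sum.inl true)]
        simp [code, withOutput, withCounters, update_withOutput_some, withCounters_update_rgt,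
          cut_rgt, update_rgt]
      | cons a u' ih =>
        have hstep : TM2.step M
            ⟨some (emb (Sum.inl true)), v, withOutput o (withCounters (cut u (a :: u')) s)⟩ =
            some ⟨some (emb (Sum.inr ⟨a, (p a).entry⟩)), some a,
              withOutput o (withCounters (cut (a :: u) u') s)⟩ := by
          simp only [TM2.step, hM (Sum.inl true)]
          simp [code, withOutput, withCounters, update_withOutput_some, withCounters_update_lft,
            withCounters_update_rgt, cut_lft, update_lft, cut_rgt, update_rgt]
        obtain ⟨v', hbody⟩ := hp a (Nat.le_of_succ_le hd) (fun l => emb (Sum.inr ⟨a, l⟩))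
          (emb (Sum.inl true)) (fun l => (hM (Sum.inr ⟨a, l⟩)).trans (by simp [code]))
          (cut (a :: u) u') (fun j hj => by
            rw [← hl j (Nat.lt_succ_of_lt hj)]
            simp [cut, Fin.ext_iff, hj.ne])
          (fun j hj => by
            rw [← hr j (Nat.lt_succ_of_lt hj)]
            simp [cut, Fin.ext_iff, hj.ne]) s (some a)
        have htime : (p a).time.eval w.length ≤ (∑ a, (p a).time).eval w.length := by
          rw [Polynomial.eval_finsetSum]
          exact Finset.single_le_sum (f := fun a => (p a).time.eval w.length)
            (fun _ _ => Nat.zero_le _) (Finset.mem_univ a)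
        have := ((ReachesIn.single hstep).trans hbody).trans (ih (a :: u) ((p a).eval w s) v')
        rw [List.reverse_cons, List.append_assoc, List.singleton_append, List.foldl_cons,
          List.length_cons]
        refine this.mono ?_
        rw [add_mul, one_mul]
        omega
    refine ⟨none, ?_⟩
    have h1 := rewind w.reverse [] s v
    have h2 := h1.trans (loop _ [] s none)
    rw [List.reverse_reverse, List.append_nil, List.append_nil, hcut] at h2
    refine h2.mono ?_
    simp only [time, Polynomial.eval_add, Polynomial.eval_mul, Polynomial.eval_X,
      Polynomial.eval_ofNat, List.length_reverse, mul_add]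
    omega

end Compile

section Machine

/-- The phases of the machine for a program, besides the execution of the program: making the
copies of the input, writing the answer, and clearing the working stacks. -/
inductive Phase
  | load
  | answer
  | clear
  deriving DecidableEq

instance : Fintype Phase where
  elems := {.load, .answer, .clear}
  complete := by rintro ⟨⟩ <;> simp

variable {α R : Type} [DecidableEq R] {D : ℕ}

open TM2.Stmt

theorem stepAux_push_all {Λ : Type} (o : List Bool)
    (q : TM2.Stmt (StackAlphabet α R D) Λ (Option α)) (f : Option α → α) (v : Option α)
    (l : List (Fin D)) (hl : l.Nodup) (S : Stack R D → List α) :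
    TM2.stepAux (l.foldr (fun j q => push (some (.lft j)) f q) q) v (withOutput o S) =
      TM2.stepAux q v (withOutput o fun x => match x with
        | .lft j => if j ∈ l then f v :: S (.lft j) else S (.lft j)
        | x => S x) := by
  induction l generalizing S with
  | nil =>
    congr 2
    funext x
    cases x <;> simp
  | cons i l ih =>
    rw [List.nodup_cons] at hl
    simp only [List.foldr_cons, TM2.stepAux, update_withOutput_some, ih hl.2]
    congr 2
    funext x
    cases x with
    | lft j =>
      by_cases hj : j = i
      · subst hj; simp [hl.1, withOutput]
      · simp [hj]
    | _ => simp

/-- Popping all stacks in a list removes their top symbols, and the state tells whether there was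
any symbol to remove. -/
theorem stepAux_pop_all {Λ : Type} (o : List Bool)
    (q : TM2.Stmt (StackAlphabet α R D) Λ (Option α)) (v : Option α) (l : List (Stack R D))
    (hl : l.Nodup) (S : Stack R D → List α) :
    ∃ v' : Option α, (v' = none ↔ v = none ∧ ∀ x ∈ l, S x = []) ∧
    TM2.stepAux (l.foldr (fun x q => pop (some x) (fun v a => v <|> a) q) q) v (withOutput o S) =
      TM2.stepAux q v' (withOutput o fun x => if x ∈ l then (S x).tail else S x) := by
  induction l generalizing S v with
  | nil => exact ⟨v, by simp, by simp⟩
  | cons y l ih =>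
    rw [List.nodup_cons] at hl
    obtain ⟨v', hv', h⟩ := ih (v <|> (S y).head?) hl.2 (Function.update S y (S y).tail)
    refine ⟨v', ?_, ?_⟩
    · rw [hv']
      have (x) (hx : x ∈ l) : Function.update S y (S y).tail x = S x :=
        Function.update_of_ne (by rintro rfl; exact hl.1 hx) _ _
      simp +contextual only [this, List.mem_cons, forall_eq_or_imp]
      cases v <;> simp [List.head?_eq_none_iff]
    · simp only [List.foldr_cons, TM2.stepAux, update_withOutput_some]
      refine Eq.trans ?_ (h.trans ?_)
      · rfl
      · congr 2
        funext x
        by_cases hx : x = y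
        · subst hx; simp [hl.1]
        · simp [hx]

variable [Inhabited α] [Fintype R]

/-- The statements of the machine that runs a program and outputs whether the counter `res` is
positive in the end. As a machine has to halt with all stacks but the output stack empty, the phase
`clear` pops all working stacks at once until none of them has a symbol left. -/
noncomputable def machineCode (p : Prog α R D) (res : R) : p.Label ⊕ Phase →
    TM2.Stmt (StackAlphabet α R D) (p.Label ⊕ Phase) (Option α)
  | Sum.inl l => code le_rfl p Sum.inl (Sum.inr .answer) l
  | Sum.inr .load => pop (some .inp) (fun _ a => a) (branch Option.isSome
      ((List.finRange D).foldr (fun j q => push (some (.lft j)) (fun v => v.getD default) q)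
        (goto fun _ => Sum.inr .load))
      (goto fun _ => Sum.inl p.entry))
  | Sum.inr .answer => peek (some (.reg res)) (fun _ a => a)
      (push none Option.isSome (goto fun _ => Sum.inr .clear))
  | Sum.inr .clear => TM2.Stmt.load (fun _ => none)
      ((Finset.univ : Finset (Stack R D)).toList.foldr
        (fun x q => pop (some x) (fun v a => v <|> a) q)
        (branch Option.isSome (goto fun _ => Sum.inr .clear) halt))

/-- The machine that runs a program and outputs whether the counter `res` is positive in the
end. -/
noncomputable def machine [Fintype α] (p : Prog α R D) (res : R) : FinTM2 :=
  haveI := p.finite_label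
  haveI := Fintype.ofFinite p.Label
  { K := Option (Stack R D)
    k₀ := some .inp
    k₁ := none
    Γ := StackAlphabet α R D
    Λ := p.Label ⊕ Phase
    main := Sum.inr .load
    σ := Option α
    initialState := none
    Γk₀Fin := inferInstanceAs (Fintype α)
    m := machineCode p res }

/-- The working stacks after the input has been cut into the reverse of `u`, which has been copied,
and `u'`, which has not. -/
def loading (u u' : List α) : Stack R D → List α
  | .inp => u'
  | .reg _ => []
  | .lft _ => u
  | .rgt _ => []

theorem reachesIn_load (p : Prog α R D) (res : R) (u' u : List α) (v : Option α) :
    ReachesIn (machineCode p res) (u'.length + 1)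
      ⟨some (Sum.inr .load), v, withOutput [] (loading u u')⟩
      ⟨some (Sum.inl p.entry), none, withOutput [] (loading (u'.reverse ++ u) [])⟩ := by
  induction u' generalizing u v with
  | nil =>
    refine ReachesIn.single ?_
    simp only [TM2.step, machineCode, TM2.stepAux, update_withOutput_some]
    simp only [withOutput, loading, List.head?_nil, List.tail_nil, Option.isSome_none, cond_false,
      List.reverse_nil, List.nil_append, Option.some.injEq, TM2.Cfg.mk.injEq, true_and]
    congr 1
    funext x
    cases x <;> simp [loading]
  | cons a u' ih =>
    rw [List.reverse_cons, List.append_assoc, List.singleton_append, List.length_cons,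
      add_comm _ 1]
    refine (ReachesIn.single ?_).trans (ih (a :: u) (some a))
    simp only [TM2.step, machineCode, TM2.stepAux, update_withOutput_some]
    simp only [withOutput, loading, List.head?_cons, List.tail_cons, Option.isSome_some, cond_true]
    rw [stepAux_push_all _ _ _ _ _ (List.nodup_finRange D)]
    simp only [TM2.stepAux, Option.some.injEq, TM2.Cfg.mk.injEq, true_and]
    congr 1
    funext x
    cases x <;> simp [loading]

theorem reachesIn_clear (p : Prog α R D) (res : R) (o : List Bool) (n : ℕ)
    (S : Stack R D → List α) (hS : ∀ x, (S x).length ≤ n) (v : Option α) :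
    ReachesIn (machineCode p res) (n + 1)
      ⟨some (Sum.inr .clear), v, withOutput o S⟩ ⟨none, none, withOutput o fun _ => []⟩ := by
  obtain ⟨v', hv', h⟩ := stepAux_pop_all o
    (branch Option.isSome (goto fun _ => (Sum.inr .clear : p.Label ⊕ Phase)) halt)
    none (Finset.univ : Finset (Stack R D)).toList (Finset.nodup_toList _) S
  simp only [Finset.mem_toList, Finset.mem_univ, if_true, true_and, true_implies] at hv' h
  have hstep := (ReachesIn.single (M := machineCode p res)
    (a := ⟨some (Sum.inr .clear), v, withOutput o S⟩) (by
      simp only [TM2.step, machineCode, TM2.stepAux]; exact congrArg some h))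
  by_cases hv : v' = none
  · have hS' := hv'.1 hv
    rw [hv] at hstep
    simp only [TM2.stepAux, hS', List.tail_nil, Option.isSome_none, cond_false] at hstep
    exact hstep.mono (by omega)
  · rw [TM2.stepAux, Option.isSome_iff_ne_none.2 hv, cond_true, TM2.stepAux] at hstep
    cases n with
    | zero => exact absurd (hv'.2 fun x => List.length_eq_zero_iff.1 (Nat.le_zero.1 (hS x))) hv
    | succ n =>
      rw [add_comm _ 1]
      refine hstep.trans (reachesIn_clear p res o n _ (fun x => ?_) v')
      have := hS x
      simp only [List.length_tail]
      omega

/-- A language is in P if membership is decided by a loop program that is started with all counters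
at zero, where a positive final value of the counter `res` means acceptance. -/
theorem inP_of_prog [Fintype α] {L : Language α} (p : Prog α R D) (res : R)
    (h : ∀ w, w ∈ L ↔ p.eval w (fun _ => 0) res ≠ 0) : ApprovalVoting.InP L := by
  classical
  refine ⟨⟨⟨machine p res, Equiv.refl α, Equiv.refl Bool⟩,
    2 * Polynomial.X + 2 * p.time + 4, fun w => Nonempty.some ?_⟩⟩
  have hinit : @Eq (TM2.Cfg (StackAlphabet α R D) (p.Label ⊕ Phase) (Option α))
      (initList (machine p res) (List.map id w))
      ⟨some (Sum.inr .load), none, withOutput [] (loading [] w)⟩ := by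
    refine (congrArg (initList (machine p res)) (List.map_id w)).trans ?_
    unfold initList
    congr 1
    funext k
    match k with
    | none => rfl
    | some .inp => rfl
    | some (.reg _) => rfl
    | some (.lft _) => rfl
    | some (.rgt _) => rfl
  have hhalt (b : Bool) : @Eq (TM2.Cfg (StackAlphabet α R D) (p.Label ⊕ Phase) (Option α))
      (haltList (machine p res) [b])
      ⟨none, none, withOutput [b] fun _ => []⟩ := by
    unfold haltList
    congr 1
    funext k
    cases k <;> rfl
  -- Loading, running, answering and clearing take at most `w.length + 1`, `p.time`, `1` and
  -- `w.length + p.time + 1` steps.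
  have h1 := reachesIn_load p res w [] none
  have hload : (loading (w.reverse ++ []) [] : Stack R D → List α) =
      withCounters (loading w.reverse []) fun _ => 0 := by
    funext x
    cases x <;> simp [loading, withCounters]
  rw [hload] at h1
  obtain ⟨v, h2⟩ := reachesIn_code (M := machineCode p res) w [] le_rfl p Sum.inl (Sum.inr .answer)
    (fun _ => rfl) (loading w.reverse []) (fun _ _ => rfl) (fun _ _ => rfl) (fun _ => 0) none
  have h3 := ReachesIn.single (M := machineCode p res) (a := ⟨some (Sum.inr .answer), v,
    withOutput [] (withCounters (D := D) (loading w.reverse []) (p.eval w fun _ => 0))⟩) rfl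
  simp only [machineCode, TM2.stepAux] at h3
  rw [update_withOutput_none] at h3
  have h4 := reachesIn_clear p res (decide (w ∈ L) :: []) (w.length + p.time.eval w.length)
    (withCounters (D := D) (loading w.reverse []) (p.eval w fun _ => 0)) (fun x => by
      have := p.eval_le_add_time w (fun _ => 0)
      cases x <;> simp [withCounters, loading]
      have := this ‹R›
      omega) (List.replicate (p.eval w (fun _ => 0) res) default).head?
  have hans : (List.replicate (p.eval w (fun _ => 0) res) (default : α)).head?.isSome =
      decide (w ∈ L) := by
    rw [Bool.eq_iff_iff, decide_eq_true_iff, h w]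
    cases p.eval w (fun _ => 0) res <;> simp [List.replicate_succ]
  have h5 := ((h1.trans h2).trans h3).trans (by
    simp only [withOutput, withCounters, hans]
    exact h4)
  have h6 := h5.mono (u := (2 * Polynomial.X + 2 * p.time + 4 : Polynomial ℕ).eval w.length) (by
    simp only [Polynomial.eval_add, Polynomial.eval_mul, Polynomial.eval_X, Polynomial.eval_ofNat]
    omega)
  rw [← hinit, ← hhalt] at h6
  exact h6

end Machine

end LoopProgram

/-! ### Winning committees and approval scores -/

namespace ApprovalVoting

section Scores

variable {m n k : ℕ}

theorem avScore_exchange {E : Election m n} {S : Finset (Fin m)} {c d : Fin m} (hc : c ∈ S)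
    (hd : d ∉ S) :
    avScore E (insert d (S.erase c)) + approvalScore E c = avScore E S + approvalScore E d := by
  have h1 : d ∉ S.erase c := fun h => hd (Finset.mem_of_mem_erase h)
  have h2 := Finset.add_sum_erase S (approvalScore E) hc
  simp only [avScore, Finset.sum_insert h1]
  omega

theorem card_exchange {S : Finset (Fin m)} {c d : Fin m} (hc : c ∈ S) (hd : d ∉ S) :
    (insert d (S.erase c)).card = S.card := by
  rw [Finset.card_insert_of_notMem (fun h => hd (Finset.mem_of_mem_erase h)),
    Finset.card_erase_add_one hc]

/-- The winning committees are those that contain no candidate with a lower score than a candidate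
outside. -/
theorem mem_AV_iff {E : Election m n} {S : Finset (Fin m)} : S ∈ AV m n E k ↔
    S.card = k ∧ ∀ c ∈ S, ∀ d ∉ S, approvalScore E d ≤ approvalScore E c := by
  constructor
  · rintro ⟨hk, hS⟩
    refine ⟨hk, fun c hc d hd => ?_⟩
    have h1 := avScore_exchange (E := E) hc hd
    have h2 := hS _ ((card_exchange hc hd).trans hk)
    omega
  · rintro ⟨hk, hS⟩
    refine ⟨hk, fun T hT => ?_⟩
    have hcard : (T \ S).card = (S \ T).card := by
      have h1 := Finset.card_sdiff_add_card_inter T S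
      have h2 := Finset.card_sdiff_add_card_inter S T
      rw [Finset.inter_comm] at h2
      omega
    have h1 : avScore E T = ∑ c ∈ T ∩ S, approvalScore E c + ∑ c ∈ T \ S, approvalScore E c :=
      (Finset.sum_inter_add_sum_sdiff _ _ _).symm
    have h2 : avScore E S = ∑ c ∈ T ∩ S, approvalScore E c + ∑ c ∈ S \ T, approvalScore E c := by
      rw [Finset.inter_comm]
      exact (Finset.sum_inter_add_sum_sdiff _ _ _).symm
    rw [h1, h2]
    refine Nat.add_le_add_left ?_ _
    obtain h0 | ⟨c, hc⟩ := (S \ T).eq_empty_or_nonempty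
    · rw [h0, Finset.card_empty, Finset.card_eq_zero] at hcard
      simp [hcard]
    obtain ⟨c, hc, hmin⟩ := Finset.exists_min_image (S \ T) (approvalScore E) ⟨c, hc⟩
    calc ∑ d ∈ T \ S, approvalScore E d ≤ (T \ S).card • approvalScore E c :=
          Finset.sum_le_card_nsmul _ _ _ fun d hd =>
            hS c (Finset.mem_sdiff.1 hc).1 d (Finset.mem_sdiff.1 hd).2
      _ ≤ ∑ c ∈ S \ T, approvalScore E c := by
          rw [hcard]
          exact Finset.card_nsmul_le_sum _ _ _ hmin

theorem exists_mem_AV (E : Election m n) (hk : k ≤ m) : ∃ S, S ∈ AV m n E k := by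
  have hne : (Finset.powersetCard k (Finset.univ : Finset (Fin m))).Nonempty :=
    Finset.powersetCard_nonempty.2 (by simpa using hk)
  obtain ⟨S, hS, hmax⟩ := Finset.exists_max_image _ (avScore E) hne
  rw [Finset.mem_powersetCard] at hS
  exact ⟨S, hS.2, fun T hT => hmax T (Finset.mem_powersetCard.2 ⟨Finset.subset_univ T, hT⟩)⟩

theorem AV_eq_singleton {E : Election m n} {S : Finset (Fin m)} (hk : S.card = k)
    (hS : ∀ c ∈ S, ∀ d ∉ S, approvalScore E d < approvalScore E c) : AV m n E k = {S} := by
  ext T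
  rw [mem_AV_iff, Set.mem_singleton_iff]
  constructor
  · rintro ⟨hT, h⟩
    by_contra hne
    obtain ⟨d, hdT, hdS⟩ := Finset.not_subset.1 fun hsub =>
      hne (Finset.eq_of_subset_of_card_le hsub (by omega))
    obtain ⟨c, hcS, hcT⟩ := Finset.not_subset.1 fun hsub =>
      hne (Finset.eq_of_subset_of_card_le hsub (by omega)).symm
    exact (hS c hcS d hdS).not_ge (h d hdT c hcT)
  · rintro rfl
    exact ⟨hk, fun c hc d hd => (hS c hc d hd).le⟩

theorem AV_ne_singleton {E : Election m n} {S : Finset (Fin m)} {c d : Fin m} (hc : c ∈ S)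
    (hd : d ∉ S) (h : approvalScore E c ≤ approvalScore E d) : AV m n E k ≠ {S} := by
  intro hAV
  obtain ⟨hk, hS⟩ : S ∈ AV m n E k := hAV ▸ Set.mem_singleton S
  have h1 := avScore_exchange (E := E) hc hd
  have hT : insert d (S.erase c) ∈ AV m n E k :=
    ⟨(card_exchange hc hd).trans hk, fun T hT => (hS T hT).trans (by omega)⟩
  rw [hAV, Set.mem_singleton_iff] at hT
  exact hd (hT ▸ Finset.mem_insert_self d _)

/-- If the candidates in `F` are tied for the highest score, then the winning committees within `F`
do not depend on the score. -/
theorem AV_eq_subsets {E : Election m n} {F : Finset (Fin m)} {τ : ℕ} (hk : k ≤ F.card)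
    (hF : ∀ c ∈ F, approvalScore E c = τ) (hF' : ∀ d ∉ F, approvalScore E d < τ) :
    AV m n E k = {S | S.card = k ∧ S ⊆ F} := by
  ext S
  rw [mem_AV_iff, Set.mem_ofPred_eq]
  refine and_congr_right fun hS => ⟨fun h => ?_, fun h c hc d _ => ?_⟩
  · by_contra hsub
    obtain ⟨d, hdS, hdF⟩ := Finset.not_subset.1 hsub
    obtain ⟨c, hcF, hcS⟩ : ∃ c ∈ F, c ∉ S := by
      by_contra! hall
      exact hsub (Finset.eq_of_subset_of_card_le hall (by omega)).ge
    have h1 := h d hdS c hcS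
    have h2 := hF c hcF
    have h3 := hF' d hdF
    omega
  · rw [hF c (h hc)]
    by_cases hd : d ∈ F
    · exact (hF d hd).le
    · exact (hF' d hd).le

/-- If `F` consists of the candidates with a positive score and has at most `k` members, then all
the remaining seats are filled arbitrarily. -/
theorem AV_eq_supersets {E : Election m n} {F : Finset (Fin m)} (hk : F.card ≤ k)
    (hF : ∀ c ∈ F, 1 ≤ approvalScore E c) (hF' : ∀ d ∉ F, approvalScore E d = 0) :
    AV m n E k = {S | S.card = k ∧ F ⊆ S} := by
  ext S
  rw [mem_AV_iff, Set.mem_ofPred_eq]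
  refine and_congr_right fun hS => ⟨fun h => ?_, fun h c _ d hd => ?_⟩
  · by_contra hsub
    obtain ⟨c, hcF, hcS⟩ := Finset.not_subset.1 hsub
    obtain ⟨d, hdS, hdF⟩ : ∃ d ∈ S, d ∉ F := by
      by_contra! hall
      exact hsub (Finset.eq_of_subset_of_card_le hall (by omega)).ge
    have h1 := h d hdS c hcS
    have h2 := hF c hcF
    have h3 := hF' d hdF
    omega
  · rw [hF' d fun hdF => hd (h hdF)]
    exact Nat.zero_le _

theorem approvalScore_le (E : Election m n) (c : Fin m) : approvalScore E c ≤ n :=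
  (Finset.card_le_univ _).trans (Fintype.card_fin n).le

/-- The number of the candidates whose score is at least `t`. -/
def numAtLeast (E : Election m n) (t : ℕ) : ℕ :=
  (Finset.univ.filter fun c => t ≤ approvalScore E c).card

/-- The number of the thresholds `t` from `1` to `n` for which exactly `x` candidates have a score
of at least `t`. For `1 ≤ x < m`, this is the difference between the `x`-th and the `(x + 1)`-st
highest score. -/
def numLevels (E : Election m n) (x : ℕ) : ℕ :=
  ((Finset.Icc 1 n).filter fun t => numAtLeast E t = x).card

/-- If a set contains the candidates with the highest scores, then `numLevels` is the gap between
the lowest score inside and the highest score outside. -/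
theorem exists_numLevels_eq {E : Election m n} {S : Finset (Fin m)} (hne : S.Nonempty)
    (hlt : S.card < m) (hS : ∀ c ∈ S, ∀ d ∉ S, approvalScore E d ≤ approvalScore E c) :
    ∃ c ∈ S, ∃ d ∉ S, (∀ c' ∈ S, approvalScore E c ≤ approvalScore E c') ∧
      (∀ d' ∉ S, approvalScore E d' ≤ approvalScore E d) ∧
      approvalScore E d + numLevels E S.card = approvalScore E c := by
  obtain ⟨c, hc, hmin⟩ := Finset.exists_min_image S (approvalScore E) hne
  have hne' : Sᶜ.Nonempty := by
    rw [← Finset.card_pos, Finset.card_compl, Fintype.card_fin]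
    omega
  obtain ⟨d, hd, hmax⟩ := Finset.exists_max_image Sᶜ (approvalScore E) hne'
  rw [Finset.mem_compl] at hd
  replace hmax : ∀ d' ∉ S, approvalScore E d' ≤ approvalScore E d :=
    fun d' hd' => hmax d' (Finset.mem_compl.2 hd')
  refine ⟨c, hc, d, hd, hmin, hmax, ?_⟩
  have hle := hS c hc d hd
  have heq : ((Finset.Icc 1 n).filter fun t => numAtLeast E t = S.card) =
      Finset.Ioc (approvalScore E d) (approvalScore E c) := by
    ext t
    simp only [Finset.mem_filter, Finset.mem_Icc, Finset.mem_Ioc]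
    constructor
    · rintro ⟨-, ht⟩
      constructor
      · by_contra! h
        have hsub : insert d S ⊆ Finset.univ.filter fun c => t ≤ approvalScore E c := by
          intro e he
          rw [Finset.mem_filter]
          refine ⟨Finset.mem_univ e, ?_⟩
          obtain rfl | he := Finset.mem_insert.1 he
          · exact h
          · exact h.trans (hS e he d hd)
        have := Finset.card_le_card hsub
        rw [Finset.card_insert_of_notMem hd] at this
        unfold numAtLeast at ht
        omega
      · by_contra! h
        have hsub : (Finset.univ.filter fun c => t ≤ approvalScore E c) ⊆ S.erase c := by
          intro e he
          rw [Finset.mem_filter] at he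
          rw [Finset.mem_erase]
          refine ⟨by rintro rfl; omega, ?_⟩
          by_contra heS
          have := hS c hc e heS
          omega
        have := Finset.card_le_card hsub
        rw [Finset.card_erase_of_mem hc] at this
        have := hne.card_pos
        unfold numAtLeast at ht
        omega
    · rintro ⟨h1, h2⟩
      refine ⟨⟨by omega, h2.trans (approvalScore_le E c)⟩, ?_⟩
      unfold numAtLeast
      congr 1
      ext e
      simp only [Finset.mem_filter, Finset.mem_univ, true_and]
      constructor
      · intro he
        by_contra heS
        have := hmax e heS
        omega
      · exact fun he => h2.trans (hmin e he)
  rw [numLevels, heq, Nat.card_Ioc]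
  omega

end Scores

section Operations

variable {m n k : ℕ}

theorem approvalScore_update (E : Election m n) (v : Fin n) (A : Finset (Fin m)) (c : Fin m) :
    approvalScore (Function.update E v A) c + (if c ∈ E v then 1 else 0) =
      approvalScore E c + if c ∈ A then 1 else 0 := by
  simp only [approvalScore, Finset.card_filter]
  rw [← Finset.add_sum_erase _ _ (Finset.mem_univ v),
    ← Finset.add_sum_erase _ (fun u => if c ∈ E u then 1 else 0) (Finset.mem_univ v)]
  rw [Finset.sum_congr rfl fun u hu => by rw [Function.update_of_ne (Finset.ne_of_mem_erase hu)],
    Function.update_self]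
  omega

theorem Op.Step.score_le {op : Op} {E F : Election m n} (h : op.Step E F) (c : Fin m) :
    approvalScore F c ≤ approvalScore E c + 1 ∧ approvalScore E c ≤ approvalScore F c + 1 := by
  have key (v A) := approvalScore_update E v A c
  cases op
  · obtain ⟨v, d, -, rfl⟩ := h
    have := key v (insert d (E v))
    split_ifs at this <;> omega
  · obtain ⟨v, d, -, rfl⟩ := h
    have := key v ((E v).erase d)
    split_ifs at this <;> omega
  · obtain ⟨v, d, e, -, -, rfl⟩ := h
    have := key v (insert e ((E v).erase d))
    split_ifs at this <;> omega

theorem Op.Steps.score_le {op : Op} {t : ℕ} {E F : Election m n} (h : op.Steps t E F)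
    (c : Fin m) :
    approvalScore F c ≤ approvalScore E c + t ∧ approvalScore E c ≤ approvalScore F c + t := by
  induction h with
  | refl => simp
  | tail _ h ih =>
    have := h.score_le c
    omega

theorem Op.Steps.score_le_of_add {t : ℕ} {E F : Election m n} (h : Op.add.Steps t E F)
    (c : Fin m) : approvalScore E c ≤ approvalScore F c := by
  induction h with
  | refl => exact le_rfl
  | @tail t F G H _ h ih =>
    obtain ⟨v, d, hd, rfl⟩ := h
    refine ih.trans ?_
    have := approvalScore_update G v (insert d (G v)) c
    by_cases hcv : c ∈ G v
    · simpa [hcv] using this.ge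
    · simp only [hcv, if_false] at this
      split_ifs at this <;> omega

theorem Op.Steps.score_le_of_remove {t : ℕ} {E F : Election m n} (h : Op.remove.Steps t E F)
    (c : Fin m) : approvalScore F c ≤ approvalScore E c := by
  induction h with
  | refl => exact le_rfl
  | @tail t F G H _ h ih =>
    obtain ⟨v, d, hd, rfl⟩ := h
    refine le_trans ?_ ih
    have := approvalScore_update G v ((G v).erase d) c
    by_cases hcv : c ∈ G v
    · simp only [hcv, if_true] at this
      split_ifs at this <;> omega
    · simpa [hcv] using this.le

/-- A nonempty sequence of operations starts with an operation. -/
theorem Op.Steps.exists_step {op : Op} {t : ℕ} {E F : Election m n} (h : op.Steps t E F) :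
    (t = 0 ∧ F = E) ∨ (1 ≤ t ∧ ∃ G, op.Step E G) := by
  induction h with
  | refl => exact Or.inl ⟨rfl, rfl⟩
  | tail _ h ih =>
    obtain ⟨-, rfl⟩ | ⟨-, h'⟩ := ih
    · exact Or.inr ⟨by omega, _, h⟩
    · exact Or.inr ⟨by omega, h'⟩

theorem exists_add_steps (E : Election m n) (d : Fin m) (j : ℕ) (hj : approvalScore E d + j ≤ n) :
    ∃ F, Op.add.Steps j E F ∧
      approvalScore F = Function.update (approvalScore E) d (approvalScore E d + j) := by
  induction j with
  | zero => exact ⟨E, .refl E, by simp⟩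
  | succ j ih =>
    obtain ⟨F, hF, hs⟩ := ih (by omega)
    have hd : approvalScore F d = approvalScore E d + j := by simp [hs]
    obtain ⟨v, hv⟩ : ∃ v, d ∉ F v := by
      by_contra! hall
      have : approvalScore F d = n := by simp [approvalScore, hall]
      omega
    refine ⟨_, .tail hF ⟨v, d, hv, rfl⟩, ?_⟩
    funext c
    have := approvalScore_update F v (insert d (F v)) c
    by_cases hc : c = d
    · subst hc
      simp [hv] at this
      simp [this, hd, add_assoc]
    · simp only [Finset.mem_insert, hc, false_or, add_left_inj] at this
      simp [this, hs, hc]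

theorem exists_remove_steps (E : Election m n) (d : Fin m) (j : ℕ) (hj : j ≤ approvalScore E d) :
    ∃ F, Op.remove.Steps j E F ∧
      approvalScore F = Function.update (approvalScore E) d (approvalScore E d - j) := by
  induction j with
  | zero => exact ⟨E, .refl E, by simp⟩
  | succ j ih =>
    obtain ⟨F, hF, hs⟩ := ih (by omega)
    have hd : approvalScore F d = approvalScore E d - j := by simp [hs]
    obtain ⟨v, hv⟩ : ∃ v, d ∈ F v := by
      by_contra! hall
      have : approvalScore F d = 0 := by simp [approvalScore, hall]
      omega
    refine ⟨_, .tail hF ⟨v, d, hv, rfl⟩, ?_⟩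
    funext c
    have := approvalScore_update F v ((F v).erase d) c
    by_cases hc : c = d
    · subst hc
      simp [hv] at this
      simp; omega
    · simp only [Finset.mem_erase, ne_eq, hc, not_false_eq_true, true_and, add_left_inj] at this
      simp [this, hs, hc]

theorem exists_mem_notMem_of_score_lt {E : Election m n} {c d : Fin m}
    (h : approvalScore E d < approvalScore E c) : ∃ v, c ∈ E v ∧ d ∉ E v := by
  by_contra! hall
  refine h.not_ge (Finset.card_le_card fun v hv => ?_)
  simp only [Finset.mem_filter, Finset.mem_univ, true_and] at hv ⊢
  exact hall v hv

theorem swap_step_score (E : Election m n) {v : Fin n} {c d : Fin m} (hc : c ∈ E v) (hd : d ∉ E v) :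
    ∃ F, Op.swap.Step E F ∧ approvalScore F c + 1 = approvalScore E c ∧
      approvalScore F d = approvalScore E d + 1 ∧
      ∀ e, e ≠ c → e ≠ d → approvalScore F e = approvalScore E e := by
  have hcd : c ≠ d := by rintro rfl; exact hd hc
  refine ⟨_, ⟨v, c, d, hc, hd, rfl⟩, ?_, ?_, fun e hec hed => ?_⟩
  · have := approvalScore_update E v (insert d ((E v).erase c)) c
    simpa [hc, hcd] using this
  · have := approvalScore_update E v (insert d ((E v).erase c)) d
    simpa [hd] using this
  · have := approvalScore_update E v (insert d ((E v).erase c)) e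
    simpa [hec, hed] using this

/-- As long as `c` is ahead of `d`, some voter approves `c` but not `d`, so that the gap can be
closed by two. -/
theorem exists_swap_steps (E : Election m n) {c d : Fin m} (j : ℕ)
    (hj : approvalScore E d + 2 * j ≤ approvalScore E c + 1) :
    ∃ F, Op.swap.Steps j E F ∧ approvalScore F c + j = approvalScore E c ∧
      approvalScore F d = approvalScore E d + j := by
  induction j with
  | zero => exact ⟨E, .refl E, rfl, rfl⟩
  | succ j ih =>
    obtain ⟨F, hF, hc, hd⟩ := ih (by omega)
    obtain ⟨v, hcv, hdv⟩ := exists_mem_notMem_of_score_lt (E := F) (c := c) (d := d) (by omega)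
    obtain ⟨G, hG, hc', hd', -⟩ := swap_step_score F hcv hdv
    exact ⟨G, .tail hF hG, by omega, by omega⟩

end Operations

/-! ### The robustness radius -/

section Radius

variable {m n k : ℕ}

theorem card_filter_score_eq_max (E : Election m n) :
    (Finset.univ.filter fun c => approvalScore E c = n).card = numAtLeast E n := by
  unfold numAtLeast
  congr 1
  ext c
  have := approvalScore_le E c
  simp only [Finset.mem_filter, Finset.mem_univ, true_and]
  omega

/-- If the scores within some winning committee exceed those outside by more than the scores can
change, then the committee remains the only winner. -/
theorem AV_eq_of_lt {E F : Election m n} {S : Finset (Fin m)} {j : ℕ} (hk : 1 ≤ k) (hkm : k < m)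
    (hS : S ∈ AV m n E k) (hj : j < numLevels E k)
    (h : ∀ c d, approvalScore E d + j < approvalScore E c → approvalScore F d < approvalScore F c) :
    AV m n E k = AV m n F k := by
  obtain ⟨hcard, htop⟩ := mem_AV_iff.1 hS
  obtain ⟨c, -, d, -, hmin, hmax, hgap⟩ := exists_numLevels_eq
    (Finset.card_pos.1 (by omega)) (by omega) htop
  rw [hcard] at hgap
  have key (c') (hc' : c' ∈ S) (d') (hd' : d' ∉ S) :
      approvalScore E d' + j < approvalScore E c' := by
    have h1 := hmin c' hc'
    have h2 := hmax d' hd'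
    omega
  rw [AV_eq_singleton hcard fun c hc d hd => by have := key c hc d hd; omega,
    AV_eq_singleton hcard fun c hc d hd => h c d (key c hc d hd)]

theorem AV_eq_of_card_eq (E F : Election m n) : AV m n E m = AV m n F m := by
  ext S
  simp only [mem_AV_iff]
  refine and_congr_right fun hS => ?_
  have : S = Finset.univ := Finset.eq_univ_of_card S (by rw [hS, Fintype.card_fin])
  simp [this]

/-- The robustness radius for adding approvals. The best way of changing the result is to let a
candidate outside a winning committee catch up, or to let it get ahead by one approval if it is tied
already. The exception is the case that more than `k` candidates are approved by all voters: they
remain tied for victory, and only another candidate that joins them can change the result. -/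
theorem add_radius_iff (E : Election m n) (hk : 1 ≤ k) (hkm : k ≤ m) (B : ℕ) :
    (∃ t ≤ B, ∃ F, Op.add.Steps t E F ∧ AV m n E k ≠ AV m n F k) ↔
      1 ≤ B ∧ k < m ∧ max k (numAtLeast E n) < m ∧
        numLevels E (max k (numAtLeast E n)) ≤ B := by
  obtain ⟨S, hS⟩ := exists_mem_AV E hkm
  obtain ⟨hcard, htop⟩ := mem_AV_iff.1 hS
  have hle := approvalScore_le E
  set T := Finset.univ.filter fun c => approvalScore E c = n with hT
  have hTcard : T.card = numAtLeast E n := card_filter_score_eq_max E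
  have hTm (c) : c ∈ T ↔ approvalScore E c = n := by simp [hT]
  have hTtop : ∀ c ∈ T, ∀ d ∉ T, approvalScore E d ≤ approvalScore E c := by
    intro c hc d _
    rw [(hTm c).1 hc]
    exact hle d
  constructor
  · rintro ⟨t, ht, F, hF, hne⟩
    have hkm' : k < m := by
      refine lt_of_le_of_ne hkm ?_
      rintro rfl
      exact hne (AV_eq_of_card_eq E F)
    have ht1 : 1 ≤ t := by
      rcases hF.exists_step with ⟨-, rfl⟩ | ⟨h, -⟩
      · exact absurd rfl hne
      · exact h
    have hup := hF.score_le
    have hmono := hF.score_le_of_add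
    refine ⟨by omega, hkm', ?_⟩
    obtain hX | hX := le_or_gt (numAtLeast E n) k
    · rw [max_eq_left hX]
      refine ⟨hkm', ?_⟩
      by_contra! hlt
      refine hne (AV_eq_of_lt hk hkm' hS (by omega : t < _) fun c d h => ?_)
      have := hup d
      have := hmono c
      omega
    · rw [max_eq_right hX.le, ← hTcard]
      by_contra! hlt
      refine hne ?_
      -- No candidate reaches the score `n`, so `T` still consists of the candidates at the top.
      have hTF (d) (hd : d ∉ T) : approvalScore F d < n := by
        obtain ⟨c, hc, e, he, -, hmax, hgap⟩ := exists_numLevels_eq (E := E) (S := T)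
          (Finset.card_pos.1 (by omega)) (by
            have := Finset.card_lt_univ_of_notMem hd
            rwa [Fintype.card_fin] at this) hTtop
        have h1 := hlt (by
          have := Finset.card_lt_univ_of_notMem hd
          rwa [Fintype.card_fin] at this)
        have h2 := hmax d hd
        have h3 := hup d
        have h4 := hle c
        omega
      rw [AV_eq_subsets (by omega) (fun c hc => (hTm c).1 hc) fun d hd =>
          lt_of_le_of_ne (hle d) fun h => hd ((hTm d).2 h),
        AV_eq_subsets (F := T) (τ := n) (by omega) (fun c hc => ?_) hTF]
      have h1 := hmono c
      have h2 := approvalScore_le F c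
      have h3 := (hTm c).1 hc
      omega
  · rintro ⟨hB, hkm', hX, hlev⟩
    obtain hX' | hX' := le_or_gt (numAtLeast E n) k
    · rw [max_eq_left hX'] at hlev
      obtain ⟨c, hc, d, hd, hmin, hmax, hgap⟩ := exists_numLevels_eq
        (Finset.card_pos.1 (by omega)) (by omega) htop
      rw [hcard] at hgap
      have hcd : d ≠ c := by rintro rfl; exact hd hc
      obtain h0 | h0 := (numLevels E k).eq_zero_or_pos
      · -- The candidates `c` and `d` are tied, and `d` can still gain an approval.
        have hdn : approvalScore E d < n := by
          refine lt_of_le_of_ne (hle d) fun hdn => ?_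
          have : insert d S ⊆ T := by
            intro e he
            rw [hTm]
            obtain rfl | he := Finset.mem_insert.1 he
            · exact hdn
            · have := hmin e he
              have := hle e
              omega
          have := Finset.card_le_card this
          rw [Finset.card_insert_of_notMem hd] at this
          omega
        obtain ⟨F, hF, hs⟩ := exists_add_steps E d 1 hdn
        refine ⟨1, hB, F, hF, fun heq => ?_⟩
        have h1 := (mem_AV_iff.1 (heq ▸ hS)).2 c hc d hd
        rw [hs, Function.update_self, Function.update_of_ne hcd.symm] at h1
        omega
      · obtain ⟨F, hF, hs⟩ := exists_add_steps E d (numLevels E k) (hgap ▸ hle c)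
        refine ⟨_, hlev, F, hF, ?_⟩
        rw [AV_eq_singleton hcard fun c' hc' d' hd' => by
          have h1 := hmin c' hc'
          have h2 := hmax d' hd'
          omega]
        refine (AV_ne_singleton hc hd ?_).symm
        rw [hs, Function.update_self, Function.update_of_ne hcd.symm]
        omega
    · rw [max_eq_right hX'.le] at hlev hX
      obtain ⟨c, hc, d, hd, -, hmax, hgap⟩ := exists_numLevels_eq (E := E) (S := T)
        (Finset.card_pos.1 (by omega)) (by omega) hTtop
      have hcn := (hTm c).1 hc
      rw [hTcard] at hgap
      obtain ⟨F, hF, hs⟩ := exists_add_steps E d _ (hgap.trans hcn).le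
      refine ⟨_, hlev, F, hF, fun heq => ?_⟩
      -- Now that `d` has the score `n`, any `k` of the candidates with this score win.
      obtain ⟨S', hdS', hS'T, hS'k⟩ := Finset.exists_subsuperset_card_eq
        (s := {d}) (t := insert d T) (n := k) (by simp) (by simpa) (by
          rw [Finset.card_insert_of_notMem hd]; omega)
      rw [Finset.singleton_subset_iff] at hdS'
      have h1 : S' ∈ AV m n F k := by
        refine mem_AV_iff.2 ⟨hS'k, fun e he f _ => ?_⟩
        have : approvalScore F e = n := by
          rw [hs]
          obtain rfl | he := Finset.mem_insert.1 (hS'T he)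
          · rw [Function.update_self]; omega
          · rw [Function.update_of_ne (by rintro rfl; exact hd he), (hTm e).1 he]
        rw [this]
        exact approvalScore_le F f
      obtain ⟨e, heT, heS'⟩ : ∃ e ∈ T, e ∉ S' := by
        by_contra! hall
        have := Finset.card_le_card (show T ⊆ S' from hall)
        omega
      have h2 := (mem_AV_iff.1 (heq ▸ h1)).2 d hdS' e heS'
      rw [(hTm e).1 heT] at h2
      exact hd ((hTm d).2 (le_antisymm (hle d) h2))

/-- The robustness radius for removing approvals. The best way of changing the result is to let a
candidate inside a winning committee fall back to a candidate outside, or to fall behind by one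
approval if they are tied already. The exception is the case that fewer than `k` candidates have a
positive score: then the result changes only when one of these candidates loses all its
approvals. -/
theorem remove_radius_iff (E : Election m n) (hk : 1 ≤ k) (hkm : k ≤ m) (B : ℕ) :
    (∃ t ≤ B, ∃ F, Op.remove.Steps t E F ∧ AV m n E k ≠ AV m n F k) ↔
      1 ≤ B ∧ k < m ∧ 1 ≤ numAtLeast E 1 ∧ numLevels E (min k (numAtLeast E 1)) ≤ B := by
  obtain ⟨S, hS⟩ := exists_mem_AV E hkm
  obtain ⟨hcard, htop⟩ := mem_AV_iff.1 hS
  set T := Finset.univ.filter fun c => 1 ≤ approvalScore E c with hT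
  have hTcard : T.card = numAtLeast E 1 := rfl
  have hTm (c) : c ∈ T ↔ 1 ≤ approvalScore E c := by simp [hT]
  have hTm' (c) (hc : c ∉ T) : approvalScore E c = 0 := by
    rw [hTm] at hc
    omega
  have hTtop : ∀ c ∈ T, ∀ d ∉ T, approvalScore E d ≤ approvalScore E c := by
    intro c _ d hd
    rw [hTm' d hd]
    exact Nat.zero_le _
  constructor
  · rintro ⟨t, ht, F, hF, hne⟩
    have hkm' : k < m := by
      refine lt_of_le_of_ne hkm ?_
      rintro rfl
      exact hne (AV_eq_of_card_eq E F)
    have ht1 : 1 ≤ t := by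
      rcases hF.exists_step with ⟨-, rfl⟩ | ⟨h, -⟩
      · exact absurd rfl hne
      · exact h
    have hup := hF.score_le
    have hmono := hF.score_le_of_remove
    refine ⟨by omega, hkm', ?_⟩
    obtain hX | hX := le_or_gt k (numAtLeast E 1)
    · rw [min_eq_left hX]
      refine ⟨by omega, ?_⟩
      by_contra! hlt
      refine hne (AV_eq_of_lt hk hkm' hS (by omega : t < _) fun c d h => ?_)
      have := hup c
      have := hmono d
      omega
    · rw [min_eq_right hX.le, ← hTcard]
      by_contra! hlt
      refine hne ?_
      -- No candidate loses all its approvals, so the zero scores are the same in both elections.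
      have hTF (c') (hc' : c' ∈ T) : 1 ≤ approvalScore F c' := by
        have hpos : 1 ≤ T.card := Finset.card_pos.2 ⟨c', hc'⟩
        obtain ⟨c, hc, e, he, hmin, -, hgap⟩ := exists_numLevels_eq (E := E) (S := T)
          ⟨c', hc'⟩ (by omega) hTtop
        have h1 := hlt hpos
        have h2 := hmin c' hc'
        have h3 := hup c'
        omega
      rw [AV_eq_supersets (by omega) (fun c hc => (hTm c).1 hc) hTm',
        AV_eq_supersets (F := T) (by omega) hTF fun d hd => ?_]
      have h1 := hmono d
      have h2 := hTm' d hd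
      omega
  · rintro ⟨hB, hkm', hX, hlev⟩
    obtain hX' | hX' := le_or_gt k (numAtLeast E 1)
    · rw [min_eq_left hX'] at hlev
      obtain ⟨c, hc, d, hd, hmin, hmax, hgap⟩ := exists_numLevels_eq
        (Finset.card_pos.1 (by omega)) (by omega) htop
      rw [hcard] at hgap
      have hcd : d ≠ c := by rintro rfl; exact hd hc
      obtain h0 | h0 := (numLevels E k).eq_zero_or_pos
      · -- The candidates `c` and `d` are tied, and `c` has an approval to lose.
        have hcn : 1 ≤ approvalScore E c := by
          by_contra! hc0
          have : T ⊆ S.erase c := by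
            intro e he
            rw [hTm] at he
            refine Finset.mem_erase.2 ⟨by rintro rfl; omega, ?_⟩
            by_contra heS
            have := htop c hc e heS
            omega
          have := Finset.card_le_card this
          rw [Finset.card_erase_of_mem hc] at this
          omega
        obtain ⟨F, hF, hs⟩ := exists_remove_steps E c 1 hcn
        refine ⟨1, hB, F, hF, fun heq => ?_⟩
        have h1 := (mem_AV_iff.1 (heq ▸ hS)).2 c hc d hd
        rw [hs, Function.update_self, Function.update_of_ne hcd] at h1
        omega
      · obtain ⟨F, hF, hs⟩ := exists_remove_steps E c (numLevels E k) (by omega)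
        refine ⟨_, hlev, F, hF, ?_⟩
        rw [AV_eq_singleton hcard fun c' hc' d' hd' => by
          have h1 := hmin c' hc'
          have h2 := hmax d' hd'
          omega]
        refine (AV_ne_singleton hc hd ?_).symm
        rw [hs, Function.update_self, Function.update_of_ne hcd]
        omega
    · rw [min_eq_right hX'.le] at hlev
      obtain ⟨c, hc, d, hd, -, -, hgap⟩ := exists_numLevels_eq (E := E) (S := T)
        (Finset.card_pos.1 (by omega)) (by omega) hTtop
      have hd0 := hTm' d hd
      rw [hTcard] at hgap
      obtain ⟨F, hF, hs⟩ := exists_remove_steps E c (numLevels E (numAtLeast E 1)) (by omega)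
      refine ⟨_, hlev, F, hF, fun heq => ?_⟩
      -- Now that `c` has the score zero, a winning committee need not contain `c`.
      obtain ⟨S', hTS', hS'c, hS'k⟩ := Finset.exists_subsuperset_card_eq
        (s := T.erase c) (t := Finset.univ.erase c) (n := k)
        (Finset.erase_subset_erase c (Finset.subset_univ T))
        (by rw [Finset.card_erase_of_mem hc]; omega)
        (by rw [Finset.card_erase_of_mem (Finset.mem_univ c), Finset.card_fin]; omega)
      have hcS' : c ∉ S' := fun h => Finset.notMem_erase c _ (hS'c h)
      have h1 : S' ∈ AV m n F k := by
        refine mem_AV_iff.2 ⟨hS'k, fun e _ f hf => ?_⟩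
        have : approvalScore F f = 0 := by
          rw [hs]
          by_cases hfc : f = c
          · subst hfc
            rw [Function.update_self]; omega
          · rw [Function.update_of_ne hfc]
            exact hTm' f fun hfT => hf (hTS' (Finset.mem_erase.2 ⟨hfc, hfT⟩))
        rw [this]
        exact Nat.zero_le _
      obtain ⟨e, heS', heT⟩ : ∃ e ∈ S', e ∉ T := by
        by_contra! hall
        have := Finset.card_le_card (show S' ⊆ T from hall)
        have := Finset.card_le_card (show S' ⊆ T.erase c from fun e he =>
          Finset.mem_erase.2 ⟨by rintro rfl; exact hcS' he, hall e he⟩)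
        rw [Finset.card_erase_of_mem hc] at this
        omega
      have h2 := (mem_AV_iff.1 (heq ▸ h1)).2 e heS' c hcS'
      rw [hTm' e heT] at h2
      exact absurd ((hTm c).1 hc) (by omega)

/-- The robustness radius for swapping approvals. A swap changes the gap between two candidates by
at most two. It can be used as long as some vote is neither empty nor full. -/
theorem swap_radius_iff (E : Election m n) (hk : 1 ≤ k) (hkm : k ≤ m) (B : ℕ) :
    (∃ t ≤ B, ∃ F, Op.swap.Steps t E F ∧ AV m n E k ≠ AV m n F k) ↔
      1 ≤ B ∧ k < m ∧ (∃ v, (∃ c, c ∈ E v) ∧ ∃ c, c ∉ E v) ∧ numLevels E k ≤ 2 * B := by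
  obtain ⟨S, hS⟩ := exists_mem_AV E hkm
  obtain ⟨hcard, htop⟩ := mem_AV_iff.1 hS
  constructor
  · rintro ⟨t, ht, F, hF, hne⟩
    have hkm' : k < m := by
      refine lt_of_le_of_ne hkm ?_
      rintro rfl
      exact hne (AV_eq_of_card_eq E F)
    rcases hF.exists_step with ⟨-, rfl⟩ | ⟨ht1, -, v, c, d, hc, hd, -⟩
    · exact absurd rfl hne
    refine ⟨by omega, hkm', ⟨v, ⟨c, hc⟩, ⟨d, hd⟩⟩, ?_⟩
    by_contra! hlt
    refine hne (AV_eq_of_lt hk hkm' hS (by omega : 2 * t < _) fun c d h => ?_)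
    have := hF.score_le c
    have := hF.score_le d
    omega
  · rintro ⟨hB, hkm', ⟨v, ⟨e, he⟩, ⟨f, hf⟩⟩, hlev⟩
    obtain ⟨c, hc, d, hd, hmin, hmax, hgap⟩ := exists_numLevels_eq
      (Finset.card_pos.1 (by omega)) (by omega) htop
    rw [hcard] at hgap
    have hcd : d ≠ c := by rintro rfl; exact hd hc
    obtain h0 | h0 := (numLevels E k).eq_zero_or_pos
    · -- The candidates `c` and `d` are tied, and one swap in the vote of `v` can separate them.
      have lose (R : Finset (Fin m)) (hR : R ∈ AV m n E k) (a b : Fin m) (ha : a ∈ R) (hb : b ∉ R)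
          (F : Election m n) (hF : Op.swap.Step E F)
          (hlt : approvalScore F a < approvalScore F b) :
          ∃ t ≤ B, ∃ F, Op.swap.Steps t E F ∧ AV m n E k ≠ AV m n F k :=
        ⟨1, hB, F, .tail (.refl E) hF, fun heq =>
          ((mem_AV_iff.1 (heq ▸ hR)).2 a ha b hb).not_gt hlt⟩
      by_cases hcv : c ∈ E v <;> by_cases hdv : d ∈ E v
      · obtain ⟨F, hF, h1, -, h3⟩ := swap_step_score E hcv hf
        refine lose S hS c d hc hd F hF ?_
        have := h3 d hcd (by rintro rfl; exact hf hdv)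
        omega
      · obtain ⟨F, hF, h1, h2, -⟩ := swap_step_score E hcv hdv
        exact lose S hS c d hc hd F hF (by omega)
      · obtain ⟨F, hF, h1, h2, -⟩ := swap_step_score E hdv hcv
        refine lose (insert d (S.erase c)) ⟨(card_exchange hc hd).trans hcard, fun T hT => ?_⟩
          d c (Finset.mem_insert_self _ _) (by simp [hcd.symm]) F hF (by omega)
        have h4 := avScore_exchange (E := E) hc hd
        have h5 := hS.2 T hT
        omega
      · obtain ⟨F, hF, -, h2, h3⟩ := swap_step_score E he hdv
        refine lose S hS c d hc hd F hF ?_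
        have := h3 c (by rintro rfl; exact hcv he) hcd.symm
        omega
    · obtain ⟨F, hF, h1, h2⟩ := exists_swap_steps E (c := c) (d := d) ((numLevels E k + 1) / 2)
        (by omega)
      refine ⟨_, by omega, F, hF, ?_⟩
      rw [AV_eq_singleton hcard fun c' hc' d' hd' => by
        have h1 := hmin c' hc'
        have h2 := hmax d' hd'
        omega]
      exact (AV_ne_singleton hc hd (by omega)).symm

end Radius

end ApprovalVoting

/-! ### Basic loop programs -/

namespace LoopProgram

namespace Prog

infixr:65 " ;; " => Prog.seq

variable {α R : Type} [DecidableEq R] {d : ℕ} {w : List α} {s : R → ℕ} {x y t : R}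

@[simp]
theorem eval_skip : (skip : Prog α R d).eval w s = s := rfl

@[simp]
theorem eval_inc : (inc x : Prog α R d).eval w s = Function.update s x (s x + 1) := rfl

@[simp]
theorem eval_dec : (dec x : Prog α R d).eval w s = Function.update s x (s x - 1) := rfl

@[simp]
theorem eval_seq {p q : Prog α R d} : (p ;; q).eval w s = q.eval w (p.eval w s) := rfl

theorem eval_ifz {p q : Prog α R d} :
    (ifz x p q).eval w s = if s x = 0 then p.eval w s else q.eval w s := rfl

theorem eval_each {p : α → Prog α R d} :
    (each p).eval w s = w.foldl (fun s a => (p a).eval w s) s := rfl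

/-- Sets `x` to zero, if its value is at most the length of the word. -/
def clear (x : R) : Prog α R (d + 1) :=
  each fun _ => dec x

theorem eval_clear (hx : s x ≤ w.length) :
    (clear x : Prog α R (d + 1)).eval w s = Function.update s x 0 := by
  have key (u : List α) (s : R → ℕ) :
      u.foldl (fun s _ => Function.update s x (s x - 1)) s =
        Function.update s x (s x - u.length) := by
    induction u generalizing s with
    | nil => simp
    | cons a u ih => simp [ih, Nat.sub_sub, add_comm]
  exact (key w s).trans (by rw [Nat.sub_eq_zero_of_le hx])

/-- Repeatedly decrements `x` and executes `p`, until `x` is zero or this has happened as many times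
as the word has symbols. -/
def countdown (x : R) (p : Prog α R d) : Prog α R (d + 1) :=
  each fun _ => ifz x skip (dec x ;; p)

/-- The states of a countdown, indexed by the value of the counter. -/
theorem eval_countdown {p : Prog α R d} (f : ℕ → R → ℕ) (n : ℕ) (hx : ∀ j ≤ n, f j x = j)
    (hp : ∀ j < n, p.eval w (Function.update (f (j + 1)) x j) = f j) :
    (countdown x p).eval w (f n) = f (n - w.length) := by
  have key (u : List α) (n : ℕ) (hx : ∀ j ≤ n, f j x = j)
      (hp : ∀ j < n, p.eval w (Function.update (f (j + 1)) x j) = f j) :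
      u.foldl (fun s _ => if s x = 0 then s else p.eval w (Function.update s x (s x - 1))) (f n) =
        f (n - u.length) := by
    induction u generalizing n with
    | nil => simp
    | cons a u ih =>
      cases n with
      | zero => simpa [hx 0 le_rfl] using ih 0 hx hp
      | succ n =>
        simp only [List.foldl_cons, hx (n + 1) le_rfl, Nat.succ_ne_zero, if_false,
          Nat.add_sub_cancel, hp n (Nat.lt_succ_self n), List.length_cons, Nat.add_sub_add_right]
        exact ih n (fun j hj => hx j (by omega)) fun j hj => hp j (by omega)
  exact key w n hx hp

theorem eval_countdown_of_le {p : Prog α R d} (f : ℕ → R → ℕ) (n : ℕ) (hx : ∀ j ≤ n, f j x = j)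
    (hp : ∀ j < n, p.eval w (Function.update (f (j + 1)) x j) = f j) (hn : n ≤ w.length) :
    (countdown x p).eval w (f n) = f 0 := by
  rw [eval_countdown f n hx hp, Nat.sub_eq_zero_of_le hn]

/-- Adds `x` to `y` and sets `x` to zero, if the value of `x` is at most the length of the word. -/
def move (x y : R) : Prog α R (d + 1) :=
  countdown x (inc y)

theorem eval_move_general (hxy : x ≠ y) : (move x y : Prog α R (d + 1)).eval w s =
    Function.update (Function.update s x (s x - w.length)) y (s y + min (s x) w.length) := by
  have h := eval_countdown (w := w) (d := d) (p := inc y) (x := x)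
    (fun j => Function.update (Function.update s x j) y (s y + (s x - j))) (s x)
    (fun j _ => by simp [hxy]) (fun j hj => by
      funext r
      by_cases h1 : r = x
      · subst h1; simp [hxy]
      · by_cases h2 : r = y
        · subst h2; simp [hxy.symm]; omega
        · simp [h1, h2])
  simp only [Nat.sub_self, Nat.add_zero, Function.update_eq_self] at h
  rw [move, h]
  congr 1
  omega

theorem eval_move (hxy : x ≠ y) (hx : s x ≤ w.length) : (move x y : Prog α R (d + 1)).eval w s =
    Function.update (Function.update s x 0) y (s y + s x) := by
  rw [eval_move_general hxy, Nat.sub_eq_zero_of_le hx, min_eq_left hx]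

/-- Adds `x` to `y`, if the value of `x` is at most the length of the word. -/
def copy (x y t : R) : Prog α R (d + 1) :=
  countdown x (inc y ;; inc t) ;; move t x

theorem eval_copy (hxy : x ≠ y) (hxt : x ≠ t) (hyt : y ≠ t) (ht : s t = 0) (hx : s x ≤ w.length) :
    (copy x y t : Prog α R (d + 1)).eval w s = Function.update s y (s y + s x) := by
  have h := eval_countdown_of_le (w := w) (d := d) (p := inc y ;; inc t) (x := x)
    (fun j => Function.update (Function.update (Function.update s x j) y (s y + (s x - j))) t
      (s x - j)) (s x)
    (fun j _ => by simp [hxy, hxt]) (fun j hj => by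
      funext r
      by_cases h1 : r = x
      · subst h1; simp [hxy, hxt]
      · by_cases h2 : r = y
        · subst h2; simp [hxy.symm, hyt]; omega
        · by_cases h3 : r = t
          · subst h3; simp [hxt.symm, hyt.symm]; omega
          · simp [h1, h2, h3]) hx
  have h0 : Function.update s t 0 = s := by
    rw [← ht, Function.update_eq_self]
  simp only [Nat.sub_self, Nat.sub_zero, Nat.add_zero, Function.update_eq_self, h0] at h
  rw [copy, eval_seq, h, eval_move hxt.symm (by simpa using hx)]
  funext r
  by_cases h1 : r = x
  · subst h1; simp [hxy, hxt]
  · by_cases h2 : r = y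
    · subst h2; simp [hxy.symm, hyt]
    · by_cases h3 : r = t
      · subst h3; simp [hxt.symm, hyt.symm, ht]
      · simp [h1, h2, h3]

/-- Subtracts `x` from `y` (truncated at zero), if the value of `x` is at most the length of the
word. -/
def subtract (x y t : R) : Prog α R (d + 1) :=
  countdown x (dec y ;; inc t) ;; move t x

theorem eval_subtract (hxy : x ≠ y) (hxt : x ≠ t) (hyt : y ≠ t) (ht : s t = 0)
    (hx : s x ≤ w.length) :
    (subtract x y t : Prog α R (d + 1)).eval w s = Function.update s y (s y - s x) := by
  have h := eval_countdown_of_le (w := w) (d := d) (p := dec y ;; inc t) (x := x)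
    (fun j => Function.update (Function.update (Function.update s x j) y (s y - (s x - j))) t
      (s x - j)) (s x)
    (fun j _ => by simp [hxy, hxt]) (fun j hj => by
      funext r
      by_cases h1 : r = x
      · subst h1; simp [hxy, hxt]
      · by_cases h2 : r = y
        · subst h2; simp [hxy.symm, hyt]; omega
        · by_cases h3 : r = t
          · subst h3; simp [hxt.symm, hyt.symm]; omega
          · simp [h1, h2, h3]) hx
  have h0 : Function.update s t 0 = s := by
    rw [← ht, Function.update_eq_self]
  simp only [Nat.sub_self, Nat.sub_zero, Function.update_eq_self, h0] at h
  rw [subtract, eval_seq, h, eval_move hxt.symm (by simpa using hx)]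
  funext r
  by_cases h1 : r = x
  · subst h1; simp [hxy, hxt]
  · by_cases h2 : r = y
    · subst h2; simp [hxy.symm, hyt]
    · by_cases h3 : r = t
      · subst h3; simp [hxt.symm, hyt.symm, ht]
      · simp [h1, h2, h3]

/-- Replaces the value of `x` by the length of the word if it exceeds that length. -/
def cap (x t : R) : Prog α R (d + 1) :=
  move x t ;; clear x ;; move t x

theorem eval_cap (hxt : x ≠ t) (ht : s t = 0) (hx : s x ≤ 2 * w.length) :
    (cap x t : Prog α R (d + 1)).eval w s = Function.update s x (min (s x) w.length) := by
  rw [cap, eval_seq, eval_move_general hxt, eval_seq, eval_clear (by simp [hxt]; omega),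
    eval_move hxt.symm (by simp [hxt.symm, ht])]
  funext r
  by_cases h1 : r = x
  · subst h1; simp [hxt.symm, ht]
  · by_cases h2 : r = t
    · subst h2; simp [hxt.symm, ht]
    · simp [h1, h2]

/-- Doubles `x`, up to the length of the word. -/
def double (x t : R) : Prog α R (d + 1) :=
  countdown x (inc t ;; inc t) ;; move t x ;; clear t

theorem eval_double (hxt : x ≠ t) (ht : s t = 0) (hx : s x ≤ w.length) :
    (double x t : Prog α R (d + 1)).eval w s =
      Function.update s x (min (2 * s x) w.length) := by
  have h := eval_countdown_of_le (w := w) (d := d) (p := inc t ;; inc t) (x := x)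
    (fun j => Function.update (Function.update s x j) t (2 * (s x - j))) (s x)
    (fun j _ => by simp [hxt]) (fun j hj => by
      funext r
      by_cases h1 : r = x
      · subst h1; simp [hxt]
      · by_cases h3 : r = t
        · subst h3; simp [hxt.symm]; omega
        · simp [h1, h3]) hx
  have h0 : Function.update s t 0 = s := by
    rw [← ht, Function.update_eq_self]
  simp only [Nat.sub_self, Nat.sub_zero, Nat.mul_zero, Function.update_eq_self, h0] at h
  rw [double, eval_seq, h, eval_seq, eval_move_general hxt.symm,
    eval_clear (by simp [hxt.symm]; omega)]
  funext r
  by_cases h1 : r = x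
  · subst h1; simp [hxt]
  · by_cases h2 : r = t
    · subst h2; simp [ht, h1]
    · simp [h1, h2]

/-- No instruction of the program increments or decrements the counter `x`. -/
def Keeps (x : R) : {d : ℕ} → Prog α R d → Prop
  | _, skip => True
  | _, inc i => x ≠ i
  | _, dec i => x ≠ i
  | _, ifz _ p q => p.Keeps x ∧ q.Keeps x
  | _, seq p q => p.Keeps x ∧ q.Keeps x
  | _, each p => ∀ a, (p a).Keeps x

theorem Keeps.eval_eq {p : Prog α R d} (h : p.Keeps x) (w : List α) (s : R → ℕ) :
    p.eval w s x = s x := by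
  induction p generalizing s with
  | skip => rfl
  | inc i => exact Function.update_of_ne h _ _
  | dec i => exact Function.update_of_ne h _ _
  | ifz i p q hp hq =>
    rw [eval_ifz]
    split
    · exact hp h.1 s
    · exact hq h.2 s
  | seq p q hp hq => rw [eval_seq, hq h.2, hp h.1]
  | each p hp =>
    rw [eval_each]
    have key (u : List α) (s : R → ℕ) : u.foldl (fun s a => (p a).eval w s) s x = s x := by
      induction u generalizing s with
      | nil => rfl
      | cons a u ih => rw [List.foldl_cons, ih, hp a (h a)]
    exact key w s

/-- No instruction of the program decrements the counter `x`. -/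
def Increases (x : R) : {d : ℕ} → Prog α R d → Prop
  | _, skip => True
  | _, inc _ => True
  | _, dec i => x ≠ i
  | _, ifz _ p q => p.Increases x ∧ q.Increases x
  | _, seq p q => p.Increases x ∧ q.Increases x
  | _, each p => ∀ a, (p a).Increases x

theorem Increases.le_eval {p : Prog α R d} (h : p.Increases x) (w : List α) (s : R → ℕ) :
    s x ≤ p.eval w s x := by
  induction p generalizing s with
  | skip => exact le_rfl
  | inc i =>
    rw [eval_inc, Function.update_apply]
    split <;> simp_all
  | dec i => exact (Function.update_of_ne h _ _).ge
  | ifz i p q hp hq =>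
    rw [eval_ifz]
    split
    · exact hp h.1 s
    · exact hq h.2 s
  | seq p q hp hq => exact (hp h.1 s).trans (hq h.2 _)
  | each p hp =>
    rw [eval_each]
    have key (u : List α) (s : R → ℕ) : s x ≤ u.foldl (fun s a => (p a).eval w s) s x := by
      induction u generalizing s with
      | nil => exact le_rfl
      | cons a u ih => exact (hp a (h a) s).trans (ih _)
    exact key w s

end Prog

end LoopProgram

/-! ### Words that consist of blocks of bits -/

namespace ApprovalVoting

open Computability LoopProgram LoopProgram.Prog

/-- The word that lists blocks of bits, with a comma after each block. -/
def blocks (us : List (List Bool)) : List Γ' :=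
  (us.map fun u => u.map Γ'.bit ++ [Γ'.comma]).flatten

@[simp]
theorem blocks_nil : blocks [] = [] := rfl

@[simp]
theorem blocks_cons (u : List Bool) (us : List (List Bool)) :
    blocks (u :: us) = u.map Γ'.bit ++ Γ'.comma :: blocks us := by
  simp [blocks]

/-- The bits that encode a vote. -/
def voteBits {m : ℕ} (A : Finset (Fin m)) : List Bool :=
  List.ofFn fun c => decide (c ∈ A)

theorem Instance.encode_eq_blocks (I : Instance) : I.encode = blocks
    (List.replicate I.m true :: encodeNat I.k :: encodeNat I.B ::
      (List.ofFn I.E).map voteBits) := by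
  have h1 : List.replicate I.m (Γ'.bit true) = (List.replicate I.m true).map Γ'.bit := by simp
  have h2 (a : ℕ) : encodingNatΓ'.encode a = (encodeNat a).map Γ'.bit := rfl
  have h3 : (List.ofFn fun v => encodeVote (I.E v)).flatten =
      blocks ((List.ofFn I.E).map voteBits) := by
    simp [blocks, encodeVote, voteBits, List.map_ofFn, Function.comp_def]
  simp only [Instance.encode, h1, h2, h3, blocks_cons]

/-! ### The program: scores -/

/-- The counters of the decision program. The numbers of candidates and voters, the committee size
and the budget are held by the counters in the first line. Those in the second line serve for
reading the instance, and the others for the computation, where `tmp` and `aux` are for temporary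
use and `res` is the answer. -/
inductive Reg
  | cands | voters | size | budget
  | sec₁ | sec₂ | sec₃ | pow | last | col | bad
  | tmp | aux | ahead | cand | dist | score | thr | count | target | levels
  | yes | no | mixed | res
  deriving DecidableEq

instance : Fintype Reg where
  elems := {.cands, .voters, .size, .budget, .sec₁, .sec₂, .sec₃, .pow, .last, .col, .bad,
    .tmp, .aux, .ahead, .cand, .dist, .score, .thr, .count, .target, .levels,
    .yes, .no, .mixed, .res}
  complete := by rintro ⟨⟩ <;> simp

variable {d : ℕ}

/-- One step of `forVotes`, for a given symbol of the word. -/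
def forVotesStep (p : Bool → Prog Γ' Reg d) (q : Prog Γ' Reg d) : Γ' → Prog Γ' Reg d
  | .bit b => ifz .ahead (p b) skip
  | .comma => ifz .ahead q (dec .ahead)
  | _ => skip

/-- Executes `p` for each bit of a vote and `q` at the end of each vote. The counter `ahead` is
used for skipping the first three blocks of the word. -/
def forVotes (p : Bool → Prog Γ' Reg d) (q : Prog Γ' Reg d) : Prog Γ' Reg (d + 1) :=
  inc .ahead ;; inc .ahead ;; inc .ahead ;; each (forVotesStep p q)

/-- The votes are the blocks of bits after the first three. -/
theorem eval_forVotes {p : Bool → Prog Γ' Reg d} {q : Prog Γ' Reg d}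
    (hp : ∀ b, (p b).Keeps .ahead) (hq : q.Keeps .ahead) {u₁ u₂ u₃ : List Bool}
    {us : List (List Bool)} {w : List Γ'} (hw : w = blocks (u₁ :: u₂ :: u₃ :: us)) {s : Reg → ℕ}
    (hs : s .ahead = 0) :
    (forVotes p q).eval w s =
      us.foldl (fun s u => q.eval w (u.foldl (fun s b => (p b).eval w s) s)) s := by
  set step : (Reg → ℕ) → Γ' → Reg → ℕ := fun s a => (forVotesStep p q a).eval w s with hstep
  have hskip (u : List Bool) (r : List Γ') (s : Reg → ℕ) (h : s .ahead ≠ 0) :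
      (u.map Γ'.bit ++ Γ'.comma :: r).foldl step s =
        r.foldl step (Function.update s .ahead (s .ahead - 1)) := by
    induction u with
    | nil => simp [hstep, forVotesStep, eval_ifz, h]
    | cons b u ih => simpa [hstep, forVotesStep, eval_ifz, h] using ih
  have hbits (u : List Bool) (r : List Γ') (s : Reg → ℕ) (h : s .ahead = 0) :
      (u.map Γ'.bit ++ r).foldl step s = r.foldl step (u.foldl (fun s b => (p b).eval w s) s) ∧
      (u.foldl (fun s b => (p b).eval w s) s) .ahead = 0 := by
    induction u generalizing s with
    | nil => simp [h]
    | cons b u ih =>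
      have := ih ((p b).eval w s) (by rw [(hp b).eval_eq, h])
      simpa [hstep, forVotesStep, eval_ifz, h] using this
  have hvotes (us : List (List Bool)) (s : Reg → ℕ) (h : s .ahead = 0) :
      (blocks us).foldl step s =
        us.foldl (fun s u => q.eval w (u.foldl (fun s b => (p b).eval w s) s)) s := by
    induction us generalizing s with
    | nil => simp
    | cons u us ih =>
      obtain ⟨h1, h2⟩ := hbits u (Γ'.comma :: blocks us) s h
      rw [blocks_cons, h1, List.foldl_cons, List.foldl_cons, ← ih _ (by rw [hq.eval_eq, h2])]
      simp [hstep, forVotesStep, eval_ifz, h2]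
  have hback : Function.update s .ahead 0 = s := by rw [← hs, Function.update_eq_self]
  simp only [forVotes, eval_seq, eval_inc, hs, Function.update_self, Function.update_idem]
  refine (congrArg (List.foldl step _) hw).trans ?_
  rw [blocks_cons, hskip _ _ _ (by simp), blocks_cons, hskip _ _ _ (by simp), blocks_cons,
    hskip _ _ _ (by simp)]
  simp only [Function.update_self, Function.update_idem]
  rw [show 0 + 1 + 1 + 1 - 1 - 1 - 1 = 0 from rfl, hback, hvotes us s hs]

theorem Instance.m_lt_length (I : Instance) : I.m < I.encode.length := by
  simp [Instance.encode_eq_blocks]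

/-- Adds the approval score of candidate number `cand` to `score`. While a vote is read, `dist` is
the distance to the bit of that candidate. -/
def addScore : Prog Γ' Reg (d + 2) :=
  copy .cand .dist .tmp ;; inc .dist ;;
  forVotes
    (fun b => ifz .dist skip
      (dec .dist ;; if b then ifz .dist (inc .score) skip else skip))
    (clear .dist ;; copy .cand .dist .tmp ;; inc .dist) ;;
  clear .dist

theorem eval_addScore (I : Instance) {s : Reg → ℕ} (c : Fin I.m) (hc : s .cand = c)
    (htmp : s .tmp = 0) (hahead : s .ahead = 0) (hdist : s .dist = 0) :
    (addScore : Prog Γ' Reg (d + 2)).eval I.encode s =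
      Function.update s .score (s .score + approvalScore I.E c) := by
  have hm := I.m_lt_length
  have hcm := c.isLt
  set p : Bool → Prog Γ' Reg (d + 1) := fun b => ifz .dist skip
    (dec .dist ;; if b then ifz .dist (inc .score) skip else skip) with hp
  set q : Prog Γ' Reg (d + 1) := clear .dist ;; copy .cand .dist .tmp ;; inc .dist with hq
  set w := I.encode with hw
  have hpass (u : List Bool) (s : Reg → ℕ) (h : s .dist = 0) :
      u.foldl (fun s b => (p b).eval w s) s = s := by
    induction u with
    | nil => rfl
    | cons b u ih => simpa [hp, eval_ifz, h] using ih
  have hbits (u : List Bool) (j : ℕ) (s : Reg → ℕ) (h : s .dist = j + 1) (hj : j < u.length) :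
      u.foldl (fun s b => (p b).eval w s) s = Function.update (Function.update s .dist 0) .score
        (s .score + if u[j] then 1 else 0) := by
    induction u generalizing s j with
    | nil => simp at hj
    | cons b u ih =>
      cases j with
      | zero =>
        rw [List.foldl_cons, hpass u _ (by cases b <;> simp [hp, eval_ifz, h])]
        cases b <;> simp [hp, eval_ifz, h]
      | succ j =>
        rw [List.foldl_cons, ih j _ (by cases b <;> simp [hp, eval_ifz, h]) (by simpa using hj)]
        cases b <;> simp [hp, eval_ifz, h]
  have hvotes (As : List (Finset (Fin I.m))) (s : Reg → ℕ) (h : s .dist = c + 1)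
      (hc : s .cand = c) (htmp : s .tmp = 0) :
      (As.map voteBits).foldl (fun s u => q.eval w (u.foldl (fun s b => (p b).eval w s) s)) s =
        Function.update s .score (s .score + (As.map fun A => if c ∈ A then 1 else 0).sum) := by
    induction As generalizing s with
    | nil => simp
    | cons A As ih =>
      have h1 := hbits (voteBits A) c s h (by simp [voteBits])
      have h2 : (voteBits A).foldl (fun s b => (p b).eval w s) s = _ := h1
      have h3 : q.eval w ((voteBits A).foldl (fun s b => (p b).eval w s) s) =
          Function.update s .score (s .score + if c ∈ A then 1 else 0) := by
        rw [h2, hq, eval_seq, eval_clear (by simp), eval_seq,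
          eval_copy (by decide) (by decide) (by decide) (by simp [htmp]) (by simp [hc]; omega)]
        funext r
        cases r <;> simp [voteBits, hc, h]
      rw [List.map_cons, List.foldl_cons, h3, ih _ (by simp [h]) (by simp [hc]) (by simp [htmp])]
      simp [add_assoc]
  rw [addScore, eval_seq, eval_copy (by decide) (by decide) (by decide) htmp (by omega), eval_seq,
    eval_seq, eval_forVotes (p := p) (q := q) (by
      intro b
      cases b <;> simp [hp, Keeps]) (by simp [hq, Keeps, clear, copy, countdown, move])
      I.encode_eq_blocks (by simp [hahead]), ← hw, hvotes _ _ (by simp [hdist, hc]) (by simp [hc])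
      (by simp [htmp]), eval_clear (by simp [hdist, hc]; omega)]
  have hsum : ((List.ofFn I.E).map fun A => if c ∈ A then 1 else 0).sum =
      approvalScore I.E c := by
    rw [List.map_ofFn, List.sum_ofFn, approvalScore, Finset.card_filter]
    rfl
  rw [hsum]
  funext r
  cases r <;> simp [hdist]

theorem Instance.n_lt_length (I : Instance) : I.n < I.encode.length := by
  have key (us : List (List Bool)) : us.length ≤ (blocks us).length := by
    induction us with
    | nil => simp
    | cons u us ih => simp; omega
  have := key ((List.ofFn I.E).map voteBits)
  rw [List.map_ofFn, List.length_ofFn] at this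
  simp [Instance.encode_eq_blocks]
  omega

/-! ### The program: score levels -/

/-- Adds to `count` the number of the candidates whose score is at least `thr`. -/
def addCount : Prog Γ' Reg (d + 3) :=
  copy .cands .cand .tmp ;; countdown .cand
    (addScore ;; inc .score ;; subtract .thr .score .tmp ;;
      ifz .score skip (inc .count) ;; clear .score)

theorem card_filter_ge_succ {m j : ℕ} (hj : j < m) (P : Fin m → Prop) [DecidablePred P] :
    (Finset.univ.filter fun c : Fin m => j ≤ c ∧ P c).card =
      (Finset.univ.filter fun c : Fin m => j + 1 ≤ c ∧ P c).card +
        if P ⟨j, hj⟩ then 1 else 0 := by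
  split_ifs with h
  · rw [← Finset.card_insert_of_notMem (a := ⟨j, hj⟩) (by simp)]
    congr 1
    ext c
    simp only [Finset.mem_filter, Finset.mem_univ, true_and, Finset.mem_insert]
    constructor
    · rintro ⟨h1, h2⟩
      obtain h3 | h3 := h1.eq_or_lt
      · exact Or.inl (Fin.ext h3.symm)
      · exact Or.inr ⟨h3, h2⟩
    · rintro (rfl | ⟨h1, h2⟩)
      · exact ⟨le_rfl, h⟩
      · exact ⟨by omega, h2⟩
  · rw [add_zero]
    congr 1
    ext c
    simp only [Finset.mem_filter, Finset.mem_univ, true_and]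
    refine and_congr_left fun h2 => ⟨fun h1 => lt_of_le_of_ne h1 ?_, fun h1 => by omega⟩
    rintro rfl
    exact h h2

theorem eval_addCount (I : Instance) {s : Reg → ℕ} (hm : s .cands = I.m)
    (hthr : s .thr ≤ I.encode.length) (htmp : s .tmp = 0) (hahead : s .ahead = 0)
    (hdist : s .dist = 0) (hcand : s .cand = 0) (hscore : s .score = 0) :
    (addCount : Prog Γ' Reg (d + 3)).eval I.encode s =
      Function.update s .count (s .count + numAtLeast I.E (s .thr)) := by
  have hmN := I.m_lt_length
  have hnN := I.n_lt_length
  let N (j : ℕ) : ℕ :=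
    (Finset.univ.filter fun c : Fin I.m => j ≤ c ∧ s .thr ≤ approvalScore I.E c).card
  have h := eval_countdown_of_le (w := I.encode) (d := d + 2) (x := Reg.cand)
    (p := addScore ;; inc .score ;; subtract .thr .score .tmp ;;
      ifz .score skip (inc .count) ;; clear .score)
    (fun j => Function.update (Function.update s .cand j) .count (s .count + N j)) I.m
    (fun j _ => by simp) (fun j hj => by
      have hle := approvalScore_le I.E ⟨j, hj⟩
      have hN : N j = N (j + 1) + if s .thr ≤ approvalScore I.E ⟨j, hj⟩ then 1 else 0 :=
        card_filter_ge_succ hj _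
      rw [eval_seq, eval_addScore I ⟨j, hj⟩ (by simp) (by simp [htmp]) (by simp [hahead])
        (by simp [hdist]), eval_seq, eval_inc, eval_seq, eval_subtract (by decide) (by decide)
        (by decide) (by simp [htmp]) (by simpa using hthr), eval_seq, eval_ifz]
      have hiff : approvalScore I.E ⟨j, hj⟩ + 1 - s .thr = 0 ↔
          ¬ s .thr ≤ approvalScore I.E ⟨j, hj⟩ := by omega
      by_cases hs : s .thr ≤ approvalScore I.E ⟨j, hj⟩
      · rw [if_pos hs] at hN
        rw [if_neg (by simp [hscore]; omega), eval_clear (by simp [hscore]; omega)]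
        funext r
        cases r <;> simp [hscore, hN, add_assoc]
      · rw [if_neg hs] at hN
        rw [if_pos (by simp [hscore]; omega), eval_clear (by simp [hscore]; omega)]
        funext r
        cases r <;> simp [hscore, hN]) hmN.le
  have h0 : Function.update (Function.update s .cand I.m) .count (s .count + N I.m) =
      Function.update s .cand I.m := by
    have : N I.m = 0 := by
      refine Finset.card_eq_zero.2 (Finset.filter_eq_empty_iff.2 fun c _ h => ?_)
      have := c.isLt
      omega
    funext r
    cases r <;> simp [this]
  rw [h0] at h
  have h1 : N 0 = numAtLeast I.E (s .thr) := by simp [N, numAtLeast]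
  rw [addCount, eval_seq, eval_copy (by decide) (by decide) (by decide) htmp (by omega), hcand, hm,
    Nat.zero_add, h, h1, ← hcand, Function.update_eq_self]

theorem numAtLeast_le {m n : ℕ} (E : Election m n) (t : ℕ) : numAtLeast E t ≤ m :=
  (Finset.card_le_univ _).trans (Fintype.card_fin m).le

/-- Increments `levels` if `count` and `target` are equal, and clears `count`. As subtraction is
truncated, equality means that both differences are zero. -/
def compareCount : Prog Γ' Reg (d + 1) :=
  copy .target .aux .tmp ;; subtract .count .aux .tmp ;; subtract .target .count .tmp ;;
    ifz .aux (ifz .count (inc .levels) skip) skip ;; clear .aux ;; clear .count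

theorem eval_compareCount {w : List Γ'} {s : Reg → ℕ} (htarget : s .target ≤ w.length)
    (hcount : s .count ≤ w.length) (htmp : s .tmp = 0) (haux : s .aux = 0) :
    (compareCount : Prog Γ' Reg (d + 1)).eval w s = Function.update
      (Function.update s .levels (s .levels + if s .count = s .target then 1 else 0)) .count 0 := by
  rw [compareCount, eval_seq, eval_copy (by decide) (by decide) (by decide) htmp htarget, eval_seq,
    eval_subtract (by decide) (by decide) (by decide) (by simp [htmp]) (by simpa using hcount),
    eval_seq, eval_subtract (by decide) (by decide) (by decide) (by simp [htmp])
      (by simpa using htarget), eval_seq, eval_seq]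
  generalize hs' : Function.update (Function.update (Function.update s _ _) _ _) _ _ = s'
  have h1 : s' .aux = s .target - s .count := by simp [← hs', haux]
  have h2 : s' .count = s .count - s .target := by simp [← hs']
  have h3 (r : Reg) (hr : r ≠ .aux) (hr' : r ≠ .count) : s' r = s r := by simp [← hs', hr, hr']
  have h4 : (ifz .aux (ifz .count (inc .levels) skip) skip : Prog Γ' Reg (d + 1)).eval w s' =
      Function.update s' .levels
        (s' .levels + if s .count = s .target then 1 else 0) := by
    rw [eval_ifz, eval_ifz, h1, h2]
    by_cases h : s .count = s .target
    · simp [h]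
    · have : ¬ (s .target - s .count = 0 ∧ s .count - s .target = 0) := by omega
      rw [if_neg h, add_zero, Function.update_eq_self]
      split_ifs with h5 h6
      · exact (this ⟨h5, h6⟩).elim
      · rfl
      · rfl
  rw [h4, eval_clear (x := Reg.aux) (by simp [h1]; omega),
    eval_clear (x := Reg.count) (by simp [h2]; omega)]
  funext r
  by_cases hr : r = .aux
  · subst hr; simp [haux]
  · by_cases hr' : r = .count
    · subst hr'; simp
    · by_cases hr'' : r = .levels
      · subst hr''; simp [h3]
      · simp [hr, hr', hr'', h3]

/-- Adds to `levels` the number of the thresholds, from `1` to the number of voters, that are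
reached by the scores of exactly `target` candidates. -/
def addLevels : Prog Γ' Reg (d + 4) :=
  copy .voters .thr .tmp ;; countdown .thr (inc .thr ;; addCount ;; dec .thr ;; compareCount)

theorem eval_addLevels (I : Instance) {s : Reg → ℕ} (hm : s .cands = I.m) (hn : s .voters = I.n)
    (htarget : s .target ≤ I.encode.length) (htmp : s .tmp = 0) (hahead : s .ahead = 0)
    (hdist : s .dist = 0) (hcand : s .cand = 0) (hscore : s .score = 0) (hthr : s .thr = 0)
    (haux : s .aux = 0) (hcount : s .count = 0) :
    (addLevels : Prog Γ' Reg (d + 4)).eval I.encode s =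
      Function.update s .levels (s .levels + numLevels I.E (s .target)) := by
  have hmN := I.m_lt_length
  have hnN := I.n_lt_length
  let N (j : ℕ) : ℕ :=
    ((Finset.Icc (j + 1) I.n).filter fun t => numAtLeast I.E t = s .target).card
  have h := eval_countdown_of_le (w := I.encode) (d := d + 3) (x := Reg.thr)
    (p := inc .thr ;; addCount ;; dec .thr ;; compareCount)
    (fun j => Function.update (Function.update s .thr j) .levels (s .levels + N j)) I.n
    (fun j _ => by simp) (fun j hj => by
      have hle := numAtLeast_le I.E (j + 1)
      have hN : N j = N (j + 1) + if numAtLeast I.E (j + 1) = s .target then 1 else 0 := by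
        simp only [N]
        rw [← Finset.insert_Icc_add_one_left_eq_Icc (a := j + 1) (b := I.n) (by omega),
          Finset.filter_insert]
        split_ifs
        · rw [Finset.card_insert_of_notMem (by simp)]
        · rfl
      rw [eval_seq, eval_inc, eval_seq, eval_addCount I (by simp [hm]) (by simp; omega)
        (by simp [htmp]) (by simp [hahead]) (by simp [hdist]) (by simp [hcand])
        (by simp [hscore]), eval_seq, eval_dec, eval_compareCount (by simpa using htarget)
        (by simp [hcount]; omega) (by simp [htmp]) (by simp [haux])]
      funext r
      cases r <;> simp [hcount, hN, add_assoc]) hnN.le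
  have h0 : Function.update (Function.update s .thr I.n) .levels (s .levels + N I.n) =
      Function.update s .thr I.n := by
    have : N I.n = 0 := by simp [N]
    funext r
    cases r <;> simp [this]
  rw [h0] at h
  have h1 : N 0 = numLevels I.E (s .target) := rfl
  rw [addLevels, eval_seq, eval_copy (by decide) (by decide) (by decide) htmp (by omega), hthr, hn,
    Nat.zero_add, h, h1, ← hthr, Function.update_eq_self]

/-- Adds to `mixed` the number of the voters that approve some, but not all candidates. -/
def addMixed : Prog Γ' Reg (d + 2) :=
  forVotes (fun b => if b then inc .yes else inc .no)
    (ifz .yes skip (ifz .no skip (inc .mixed)) ;; clear .yes ;; clear .no)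

theorem eval_addMixed (I : Instance) {s : Reg → ℕ} (hahead : s .ahead = 0) (hyes : s .yes = 0)
    (hno : s .no = 0) : ∃ x, (x ≠ 0 ↔ ∃ v, (∃ c, c ∈ I.E v) ∧ ∃ c, c ∉ I.E v) ∧
    (addMixed : Prog Γ' Reg (d + 2)).eval I.encode s =
      Function.update s .mixed (s .mixed + x) := by
  have hmN := I.m_lt_length
  set p : Bool → Prog Γ' Reg (d + 1) := fun b => if b then inc .yes else inc .no with hp
  set q : Prog Γ' Reg (d + 1) :=
    ifz .yes skip (ifz .no skip (inc .mixed)) ;; clear .yes ;; clear .no with hq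
  have hbits (u : List Bool) (s : Reg → ℕ) : u.foldl (fun s b => (p b).eval I.encode s) s =
      Function.update (Function.update s .yes (s .yes + u.count true)) .no
        (s .no + u.count false) := by
    induction u generalizing s with
    | nil => simp
    | cons b u ih =>
      rw [List.foldl_cons, ih]
      funext r
      cases b <;> cases r <;> simp [hp] <;> omega
  have hvotes (As : List (Finset (Fin I.m))) (s : Reg → ℕ) (hyes : s .yes = 0) (hno : s .no = 0) :
      (As.map voteBits).foldl
          (fun s u => q.eval I.encode (u.foldl (fun s b => (p b).eval I.encode s) s)) s =
        Function.update s .mixed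
          (s .mixed + (As.map fun A => if A ≠ ∅ ∧ Aᶜ ≠ ∅ then 1 else 0).sum) := by
    induction As generalizing s with
    | nil => simp
    | cons A As ih =>
      have hlen : (voteBits A).length = I.m := by simp [voteBits]
      have h1 : (voteBits A).count true ≠ 0 ↔ A ≠ ∅ := by
        rw [← Nat.pos_iff_ne_zero, List.count_pos_iff, ← Finset.nonempty_iff_ne_empty]
        simp [voteBits, List.mem_ofFn, Finset.Nonempty]
      have h2 : (voteBits A).count false ≠ 0 ↔ Aᶜ ≠ ∅ := by
        rw [← Nat.pos_iff_ne_zero, List.count_pos_iff, ← Finset.nonempty_iff_ne_empty]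
        simp [voteBits, List.mem_ofFn, Finset.Nonempty]
      have h3 := (voteBits A).count_le_length (a := true)
      have h4 := (voteBits A).count_le_length (a := false)
      have h5 : q.eval I.encode ((voteBits A).foldl (fun s b => (p b).eval I.encode s) s) =
          Function.update s .mixed (s .mixed + if A ≠ ∅ ∧ Aᶜ ≠ ∅ then 1 else 0) := by
        rw [hbits, hq, eval_seq, eval_ifz, eval_ifz]
        simp only [← h1, ← h2, eval_skip, eval_inc]
        simp only [hyes, hno, Nat.zero_add, Function.update_self,
          Function.update_of_ne (show Reg.yes ≠ Reg.no by decide)]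
        split_ifs with h6 h7 h8 h9 <;> try omega
        all_goals
          rw [eval_seq, eval_clear (x := Reg.yes) (by simp; omega),
            eval_clear (x := Reg.no) (by simp; omega)]
          funext r
          cases r <;> simp [hyes, hno]
      rw [List.map_cons, List.foldl_cons, h5, ih _ (by simp [hyes]) (by simp [hno])]
      simp [add_assoc]
  refine ⟨((List.ofFn I.E).map fun A => if A ≠ ∅ ∧ Aᶜ ≠ ∅ then 1 else 0).sum, ?_, ?_⟩
  · rw [Ne, List.sum_eq_zero_iff]
    simp [List.mem_ofFn, Finset.eq_empty_iff_forall_notMem]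
  · rw [addMixed, eval_forVotes (p := p) (q := q) (by
      intro b
      cases b <;> simp [hp, Keeps]) (by simp [hq, Keeps, clear])
      I.encode_eq_blocks hahead, hvotes _ _ hyes hno]

end ApprovalVoting

namespace ApprovalVoting

open Computability LoopProgram LoopProgram.Prog

/-! ### The program: reading the instance -/

/-- The number with the given binary digits, the lowest digit first. -/
def bitsValue : List Bool → ℕ
  | [] => 0
  | b :: u => (if b then 1 else 0) + 2 * bitsValue u

/-- Indicates whether a word of binary digits, the lowest digit first, has a leading zero, so that
it is not the encoding of a number. -/
def leadingZero (u : List Bool) : ℕ :=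
  if u.getLast? = some false then 1 else 0

theorem bitsValue_encodePosNum (p : PosNum) : bitsValue (encodePosNum p) = (p : ℕ) := by
  induction p with
  | one => simp [encodePosNum, bitsValue]
  | bit0 p ih => simp [encodePosNum, bitsValue, ih, PosNum.cast_bit0]; omega
  | bit1 p ih => simp [encodePosNum, bitsValue, ih, PosNum.cast_bit1]; omega

theorem bitsValue_encodeNat (k : ℕ) : bitsValue (encodeNat k) = k := by
  have h : ((k : Num) : ℕ) = k := Num.to_of_nat k
  rw [encodeNat]
  conv_rhs => rw [← h]
  cases (k : Num) with
  | zero => rfl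
  | pos p => exact bitsValue_encodePosNum p

theorem getLast?_encodePosNum (p : PosNum) : (encodePosNum p).getLast? = some true := by
  induction p with
  | one => rfl
  | bit0 p ih | bit1 p ih => simp [encodePosNum, List.getLast?_cons, ih]

theorem leadingZero_encodeNat (k : ℕ) : leadingZero (encodeNat k) = 0 := by
  rw [encodeNat, leadingZero]
  cases (k : Num) with
  | zero => rfl
  | pos p => simp [encodeNum, getLast?_encodePosNum]

theorem exists_encodePosNum_eq (u : List Bool) (h : u.getLast? = some true) :
    ∃ p, encodePosNum p = u := by
  induction u with
  | nil => simp at h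
  | cons b u ih =>
    cases u with
    | nil => exact ⟨.one, by simpa [encodePosNum, eq_comm] using h⟩
    | cons b' u =>
      obtain ⟨p, hp⟩ := ih (by simpa [List.getLast?_cons] using h)
      cases b
      · exact ⟨.bit0 p, by rw [encodePosNum, hp]⟩
      · exact ⟨.bit1 p, by rw [encodePosNum, hp]⟩

theorem exists_encodeNat_eq (u : List Bool) (h : leadingZero u = 0) : ∃ k, encodeNat k = u := by
  cases hu : u.getLast? with
  | none => exact ⟨0, by simpa [encodeNat, encodeNum, eq_comm] using hu⟩
  | some b =>
    cases b with
    | false => simp [leadingZero, hu] at h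
    | true =>
      obtain ⟨p, hp⟩ := exists_encodePosNum_eq u hu
      refine ⟨(Num.pos p : ℕ), ?_⟩
      rw [encodeNat, Num.of_to_nat]
      exact hp

variable {d : ℕ}

/-- Processes the next binary digit of the number that is accumulated in `x`, while `pow` is the
place value of the digit. Both numbers are kept from exceeding the length of the word. -/
def addBit (x : Reg) (b : Bool) : Prog Γ' Reg (d + 1) :=
  (if b then copy .pow x .tmp ;; cap x .tmp else skip) ;; double .pow .tmp ;;
    clear .last ;; if b then skip else inc .last

/-- Checks the last digit of a number, and prepares for the next number. -/
def endNumber : Prog Γ' Reg (d + 1) :=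
  ifz .last skip (inc .bad) ;; clear .last ;; clear .pow ;; inc .pow

theorem eval_addBit {w : List Γ'} (hw : 1 ≤ w.length) {s : Reg → ℕ} {x : Reg} (hpow : x ≠ .pow)
    (htmp' : x ≠ .tmp) (hlast' : x ≠ .last) (htmp : s .tmp = 0) (hlast : s .last ≤ 1) {a c : ℕ}
    (hx : s x = min a w.length) (hp : s .pow = min c w.length) (b : Bool) :
    (addBit x b : Prog Γ' Reg (d + 1)).eval w s =
      Function.update (Function.update (Function.update s x
        (min (a + c * if b then 1 else 0) w.length)) .pow (min (2 * c) w.length)) .last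
        (if b then 0 else 1) := by
  have hlen (s' : Reg → ℕ) (h : s' .last = s .last) : s' .last ≤ w.length := by omega
  cases b with
  | false =>
    simp only [addBit, Bool.false_eq_true, if_false, eval_seq, eval_skip, eval_inc]
    rw [eval_double (by decide) htmp (by omega), eval_clear (by simp; omega)]
    funext r
    by_cases h1 : r = .last
    · subst h1; simp
    · by_cases h2 : r = .pow
      · subst h2; simp [hp]; omega
      · by_cases h3 : r = x
        · subst h3; simp [h1, h2, hx]
        · simp [h1, h2, h3]
  | true =>
    simp only [addBit, if_true, eval_seq, eval_skip]
    rw [eval_copy hpow.symm (by decide) htmp' htmp (by omega),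
      eval_cap htmp' (by simp [htmp, htmp'.symm]) (by simp; omega),
      eval_double (by decide) (by simp [htmp, htmp'.symm]) (by simp [hpow.symm]; omega),
      eval_clear (by simp [hlast'.symm]; omega)]
    funext r
    by_cases h1 : r = .last
    · subst h1; simp
    · by_cases h2 : r = .pow
      · subst h2; simp [hp, hpow.symm]; omega
      · by_cases h3 : r = x
        · subst h3; simp [h1, h2, hx, hp]; omega
        · simp [h1, h2, h3]

theorem foldl_addBit {w : List Γ'} (hw : 1 ≤ w.length) {x : Reg} (hpow : x ≠ .pow)
    (htmp' : x ≠ .tmp) (hlast' : x ≠ .last) (u : List Bool) {s : Reg → ℕ} (htmp : s .tmp = 0)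
    (hlast : s .last ≤ 1) {a c : ℕ} (hx : s x = min a w.length) (hp : s .pow = min c w.length) :
    u.foldl (fun s b => (addBit x b : Prog Γ' Reg (d + 1)).eval w s) s =
      Function.update (Function.update (Function.update s x
        (min (a + c * bitsValue u) w.length)) .pow (min (c * 2 ^ u.length) w.length)) .last
        (if u = [] then s .last else leadingZero u) := by
  induction u generalizing s a c with
  | nil =>
    funext r
    by_cases h1 : r = .last
    · subst h1; simp
    · by_cases h2 : r = .pow
      · subst h2; simp [hp]
      · by_cases h3 : r = x
        · subst h3; simp [h1, h2, hx, bitsValue]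
        · simp [h1, h2, h3]
  | cons b u ih =>
    rw [List.foldl_cons, eval_addBit hw hpow htmp' hlast' htmp hlast hx hp,
      ih (a := a + c * if b then 1 else 0) (c := 2 * c) (by simp [htmp, htmp'.symm])
        (by cases b <;> simp) (by simp [hlast', hpow]) (by simp)]
    funext r
    by_cases h1 : r = .last
    · subst h1
      cases u with
      | nil => cases b <;> simp [leadingZero]
      | cons b' u => simp [leadingZero, List.getLast?_cons]
    · by_cases h2 : r = .pow
      · subst h2; simp [pow_succ]; ring_nf
      · by_cases h3 : r = x
        · subst h3; cases b <;> simp [h1, h2, bitsValue] <;> ring_nf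
        · simp [h1, h2, h3]

theorem eval_number {w : List Γ'} (hw : 1 ≤ w.length) {x : Reg} (hpow : x ≠ .pow)
    (htmp' : x ≠ .tmp) (hlast' : x ≠ .last) (hbad : x ≠ .bad) (u : List Bool) {s : Reg → ℕ}
    (htmp : s .tmp = 0) (hlast : s .last = 0) (hx : s x = 0) (hp : s .pow = 1) :
    (endNumber : Prog Γ' Reg (d + 1)).eval w
      (u.foldl (fun s b => (addBit x b : Prog Γ' Reg (d + 1)).eval w s) s) =
      Function.update (Function.update s x (min (bitsValue u) w.length)) .bad
        (s .bad + leadingZero u) := by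
  rw [foldl_addBit hw hpow htmp' hlast' u htmp (by omega) (a := 0) (c := 1) (by simpa using hx)
    (by rw [hp]; omega)]
  have h1 : (if u = [] then s .last else leadingZero u) = leadingZero u := by
    split
    · subst u; simpa [leadingZero] using hlast
    · rfl
  have h2 : leadingZero u = 0 ∨ leadingZero u = 1 := by
    rw [leadingZero]
    split <;> simp
  rw [h1, endNumber, eval_seq, eval_ifz]
  obtain h2 | h2 := h2
  · simp only [h2, Function.update_self, if_true, eval_skip]
    rw [eval_seq, eval_clear (by simp), eval_seq, eval_clear (by simp), eval_inc]
    funext r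
    by_cases h3 : r = .last
    · subst h3; simp [hlast, hlast'.symm]
    · by_cases h4 : r = .pow
      · subst h4; simp [hp, hpow.symm]
      · by_cases h5 : r = .bad
        · subst h5; simp [hbad.symm]
        · by_cases h6 : r = x
          · subst h6; simp [h3, h4, h5]
          · simp [h3, h4, h5, h6]
  · simp only [h2, Function.update_self, Nat.one_ne_zero, if_false, eval_inc]
    rw [eval_seq, eval_clear (by simp; omega), eval_seq, eval_clear (by simp), eval_inc]
    funext r
    by_cases h3 : r = .last
    · subst h3; simp [hlast, hlast'.symm]
    · by_cases h4 : r = .pow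
      · subst h4; simp [hp, hpow.symm]
      · by_cases h5 : r = .bad
        · subst h5; simp [hbad.symm]
        · by_cases h6 : r = x
          · subst h6; simp [h3, h4, h5]
          · simp [h3, h4, h5, h6]

/-- Checks that the length of a vote is the number of the candidates, and counts the vote. -/
def endVote : Prog Γ' Reg (d + 1) :=
  copy .cands .aux .tmp ;; subtract .col .aux .tmp ;; subtract .cands .col .tmp ;;
    ifz .aux skip (inc .bad) ;; ifz .col skip (inc .bad) ;; clear .aux ;; clear .col ;; inc .voters

theorem eval_endVote {w : List Γ'} {s : Reg → ℕ} (hcands : s .cands ≤ w.length)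
    (hcol : s .col ≤ w.length) (htmp : s .tmp = 0) (haux : s .aux = 0) :
    (endVote : Prog Γ' Reg (d + 1)).eval w s = Function.update (Function.update (Function.update s
      .bad (s .bad + if s .col = s .cands then 0 else 1)) .col 0) .voters (s .voters + 1) := by
  rw [endVote, eval_seq, eval_copy (by decide) (by decide) (by decide) htmp hcands, eval_seq,
    eval_subtract (by decide) (by decide) (by decide) (by simp [htmp]) (by simpa using hcol),
    eval_seq, eval_subtract (by decide) (by decide) (by decide) (by simp [htmp])
      (by simpa using hcands), eval_seq, eval_seq]
  generalize hs' : Function.update (Function.update (Function.update s _ _) _ _) _ _ = s'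
  have h1 : s' .aux = s .cands - s .col := by simp [← hs', haux]
  have h2 : s' .col = s .col - s .cands := by simp [← hs']
  have h3 (r : Reg) (hr : r ≠ .aux) (hr' : r ≠ .col) : s' r = s r := by simp [← hs', hr, hr']
  have h4 : (ifz .col skip (inc .bad) : Prog Γ' Reg (d + 1)).eval w
      ((ifz .aux skip (inc .bad) : Prog Γ' Reg (d + 1)).eval w s') =
      Function.update s' .bad (s .bad + if s .col = s .cands then 0 else 1) := by
    simp only [eval_ifz, eval_skip, eval_inc, h1]
    obtain h | h | h := lt_trichotomy (s .col) (s .cands)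
    · rw [if_neg (by omega : ¬ s .cands - s .col = 0), if_pos (by simp [h2]; omega),
        if_neg h.ne, h3 _ (by decide) (by decide)]
    · rw [if_pos (by omega : s .cands - s .col = 0), if_pos (by simp [h2]; omega),
        if_pos h, add_zero, ← h3 _ (by decide) (by decide), Function.update_eq_self]
    · rw [if_pos (by omega : s .cands - s .col = 0), if_neg (by simp [h2]; omega),
        if_neg h.ne', h3 _ (by decide) (by decide)]
  rw [h4, eval_seq, eval_clear (x := Reg.aux) (by simp [h1]; omega), eval_seq,
    eval_clear (x := Reg.col) (by simp [h2]; omega), eval_inc]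
  funext r
  by_cases hr : r = .aux
  · subst hr; simp [haux]
  · by_cases hr' : r = .col
    · subst hr'; simp
    · by_cases hr'' : r = .bad
      · subst hr''; simp
      · by_cases hv : r = .voters
        · subst hv; simp [h3]
        · simp [hr, hr', hr'', hv, h3]

/-- Processes the next symbol of the word. The counters `sec₁`, `sec₂` and `sec₃` tell which of the
first three commas have been read. -/
def readStep : Γ' → Prog Γ' Reg (d + 1)
  | .bit b => ifz .sec₁ (if b then inc .cands else inc .bad)
      (ifz .sec₂ (addBit .size b) (ifz .sec₃ (addBit .budget b) (inc .col)))
  | .comma => ifz .sec₁ (inc .sec₁ ;; inc .pow)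
      (ifz .sec₂ (endNumber ;; inc .sec₂) (ifz .sec₃ (endNumber ;; inc .sec₃) endVote))
  | _ => inc .bad

/-- Reads the instance. If the word is not the encoding of an instance, then this is noted by
`bad`, `sec₃` or `col`. -/
def readInstance : Prog Γ' Reg (d + 2) :=
  each readStep

/-- The counters after reading a word that consists of blocks of bits. -/
def readResult (N : ℕ) (u₁ u₂ u₃ : List Bool) (us : List (List Bool)) (tail : List Bool) : Reg → ℕ
  | .cands => u₁.count true
  | .voters => us.length
  | .size => min (bitsValue u₂) N
  | .budget => min (bitsValue u₃) N
  | .sec₁ | .sec₂ | .sec₃ | .pow => 1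
  | .col => tail.length
  | .bad => u₁.count false + leadingZero u₂ + leadingZero u₃ +
      (us.map fun u => if u.length = u₁.count true then 0 else 1).sum
  | _ => 0

/-- For the words that begin with three blocks of bits, all counters are known after reading the
word. -/
theorem eval_readInstance {w : List Γ'} {u₁ u₂ u₃ : List Bool} {us : List (List Bool)}
    {tail : List Bool} (hw : w = blocks (u₁ :: u₂ :: u₃ :: us) ++ List.map Γ'.bit tail) :
    (readInstance : Prog Γ' Reg (d + 2)).eval w (fun _ => 0) =
      readResult w.length u₁ u₂ u₃ us tail := by
  set step : (Reg → ℕ) → Γ' → Reg → ℕ :=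
    fun s a => (readStep a : Prog Γ' Reg (d + 1)).eval w s with hstep
  have hlen : 1 ≤ w.length := by simp [hw]; omega
  have hlen₁ : u₁.count true ≤ w.length := by
    have := u₁.count_le_length (a := true)
    simp [hw]; omega
  have hlen₂ : ∀ u ∈ us, u.length ≤ w.length := by
    have key (us : List (List Bool)) (u) (hu : u ∈ us) : u.length ≤ (blocks us).length := by
      induction us with
      | nil => simp at hu
      | cons u' us ih =>
        obtain rfl | hu := List.mem_cons.1 hu
        · simp
        · have := ih hu
          simp; omega
    intro u hu
    have := key us u hu
    simp [hw]; omega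
  have hblock₁ (u : List Bool) (r : List Γ') (s : Reg → ℕ) (h : s .sec₁ = 0) :
      (u.map Γ'.bit ++ Γ'.comma :: r).foldl step s = r.foldl step (Function.update (Function.update
        (Function.update (Function.update s .cands (s .cands + u.count true))
        .bad (s .bad + u.count false)) .sec₁ 1) .pow (s .pow + 1)) := by
    induction u generalizing s with
    | nil =>
      rw [List.map_nil, List.nil_append, List.foldl_cons]
      congr 1
      funext r
      cases r <;> simp [hstep, readStep, eval_ifz, h]
    | cons b u ih =>
      rw [List.map_cons, List.cons_append, List.foldl_cons, ih _
        (by cases b <;> simp [hstep, readStep, eval_ifz, h])]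
      congr 1
      funext r
      cases b <;> cases r <;> simp [hstep, readStep, eval_ifz, h] <;> omega
  have hkeep (x y : Reg) (hx : y ≠ x) (h1 : y ≠ .pow) (h2 : y ≠ .tmp) (h3 : y ≠ .last) (b : Bool) :
      (addBit x b : Prog Γ' Reg (d + 1)).Keeps y := by
    cases b <;> simp [addBit, Keeps, copy, cap, double, move, clear, countdown, hx, h1, h2, h3]
  have hbits₂ (u : List Bool) (r : List Γ') (s : Reg → ℕ) (h : s .sec₁ ≠ 0) (h' : s .sec₂ = 0) :
      (u.map Γ'.bit ++ Γ'.comma :: r).foldl step s = r.foldl step ((endNumber ;; inc .sec₂ :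
        Prog Γ' Reg (d + 1)).eval w
          (u.foldl (fun s b => (addBit .size b : Prog Γ' Reg (d + 1)).eval w s) s)) := by
    induction u generalizing s with
    | nil => simp [hstep, readStep, eval_ifz, h, h']
    | cons b u ih =>
      have h1 : step s (Γ'.bit b) = (addBit .size b : Prog Γ' Reg (d + 1)).eval w s := by
        simp [hstep, readStep, eval_ifz, h, h']
      rw [List.map_cons, List.cons_append, List.foldl_cons, h1, List.foldl_cons]
      refine ih _ ?_ ?_ <;>
        rwa [(hkeep .size _ (by decide) (by decide) (by decide) (by decide) b).eval_eq]
  have hblock₂ (u : List Bool) (r : List Γ') (s : Reg → ℕ) (h : s .sec₁ ≠ 0) (h' : s .sec₂ = 0)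
      (htmp : s .tmp = 0) (hlast : s .last = 0) (hx : s .size = 0) (hp : s .pow = 1) :
      (u.map Γ'.bit ++ Γ'.comma :: r).foldl step s = r.foldl step (Function.update (Function.update
        (Function.update s .size (min (bitsValue u) w.length)) .bad (s .bad + leadingZero u))
        .sec₂ 1) := by
    rw [hbits₂ u r s h h', eval_seq, eval_number hlen (by decide) (by decide) (by decide)
      (by decide) u htmp hlast hx hp]
    simp [h']
  have hbits₃ (u : List Bool) (r : List Γ') (s : Reg → ℕ) (h : s .sec₁ ≠ 0) (h' : s .sec₂ ≠ 0)
      (h'' : s .sec₃ = 0) :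
      (u.map Γ'.bit ++ Γ'.comma :: r).foldl step s = r.foldl step ((endNumber ;; inc .sec₃ :
        Prog Γ' Reg (d + 1)).eval w
          (u.foldl (fun s b => (addBit .budget b : Prog Γ' Reg (d + 1)).eval w s) s)) := by
    induction u generalizing s with
    | nil => simp [hstep, readStep, eval_ifz, h, h', h'']
    | cons b u ih =>
      have h1 : step s (Γ'.bit b) = (addBit .budget b : Prog Γ' Reg (d + 1)).eval w s := by
        simp [hstep, readStep, eval_ifz, h, h', h'']
      rw [List.map_cons, List.cons_append, List.foldl_cons, h1, List.foldl_cons]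
      refine ih _ ?_ ?_ ?_ <;>
        rwa [(hkeep .budget _ (by decide) (by decide) (by decide) (by decide) b).eval_eq]
  have hblock₃ (u : List Bool) (r : List Γ') (s : Reg → ℕ) (h : s .sec₁ ≠ 0) (h' : s .sec₂ ≠ 0)
      (h'' : s .sec₃ = 0) (htmp : s .tmp = 0) (hlast : s .last = 0) (hx : s .budget = 0)
      (hp : s .pow = 1) :
      (u.map Γ'.bit ++ Γ'.comma :: r).foldl step s = r.foldl step (Function.update (Function.update
        (Function.update s .budget (min (bitsValue u) w.length)) .bad (s .bad + leadingZero u))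
        .sec₃ 1) := by
    rw [hbits₃ u r s h h' h'', eval_seq, eval_number hlen (by decide) (by decide) (by decide)
      (by decide) u htmp hlast hx hp]
    simp [h'']
  have hbits₄ (u : List Bool) (r : List Γ') (s : Reg → ℕ) (h : s .sec₁ ≠ 0) (h' : s .sec₂ ≠ 0)
      (h'' : s .sec₃ ≠ 0) :
      (u.map Γ'.bit ++ r).foldl step s =
        r.foldl step (Function.update s .col (s .col + u.length)) := by
    induction u generalizing s with
    | nil => simp
    | cons b u ih =>
      have h1 : step s (Γ'.bit b) = Function.update s .col (s .col + 1) := by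
        simp [hstep, readStep, eval_ifz, h, h', h'']
      rw [List.map_cons, List.cons_append, List.foldl_cons, h1,
        ih _ (by simpa using h) (by simpa using h') (by simpa using h'')]
      simp [add_assoc, add_comm 1]
  have hvotes (us : List (List Bool)) (hus : ∀ u ∈ us, u.length ≤ w.length) (r : List Γ')
      (s : Reg → ℕ) (h : s .sec₁ ≠ 0) (h' : s .sec₂ ≠ 0) (h'' : s .sec₃ ≠ 0) (htmp : s .tmp = 0)
      (haux : s .aux = 0) (hcol : s .col = 0) (hcands : s .cands ≤ w.length) :
      (blocks us ++ r).foldl step s = r.foldl step (Function.update (Function.update s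
        .bad (s .bad + (us.map fun u => if u.length = s .cands then 0 else 1).sum))
        .voters (s .voters + us.length)) := by
    induction us generalizing s with
    | nil => simp
    | cons u us ih =>
      rw [List.forall_mem_cons] at hus
      have h1 : step (Function.update s .col (s .col + u.length)) Γ'.comma =
          Function.update (Function.update s .bad (s .bad + if u.length = s .cands then 0 else 1))
            .voters (s .voters + 1) := by
        have : step (Function.update s .col (s .col + u.length)) Γ'.comma =
            (endVote : Prog Γ' Reg (d + 1)).eval w
              (Function.update s .col (s .col + u.length)) := by
          simp [hstep, readStep, eval_ifz, h, h', h'']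
        rw [this, eval_endVote (by simpa using hcands) (by simpa [hcol] using hus.1)
          (by simpa using htmp) (by simpa using haux)]
        funext r
        cases r <;> simp [hcol]
      rw [blocks_cons, List.append_assoc, hbits₄ _ _ _ h h' h'', List.cons_append, List.foldl_cons,
        h1, ih hus.2 _ (by simpa using h) (by simpa using h') (by simpa using h'')
          (by simpa using htmp) (by simpa using haux) (by simpa using hcol) (by simpa using hcands)]
      congr 1
      funext r
      cases r <;> simp [add_assoc, add_comm 1]
  rw [readInstance, eval_each]
  refine (congrArg (List.foldl step _) hw).trans ?_
  simp only [blocks_cons, List.append_assoc, List.cons_append]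
  rw [hblock₁ _ _ _ rfl, hblock₂ _ _ _ (by simp) (by simp) (by simp) (by simp) (by simp) (by simp),
    hblock₃ _ _ _ (by simp) (by simp) (by simp) (by simp) (by simp) (by simp) (by simp),
    hvotes us hlen₂ _ _ (by simp) (by simp) (by simp) (by simp) (by simp) (by simp)
      (by simpa using hlen₁), ← List.append_nil (List.map Γ'.bit tail),
    hbits₄ _ _ _ (by simp) (by simp) (by simp)]
  funext r
  cases r <;> simp [readResult]

/-- If fewer than three commas have been read, then `sec₃` is zero. -/
theorem eval_readInstance_sec₃ {w : List Γ'} {us : List (List Bool)} {tail : List Bool}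
    (hw : w = blocks us ++ List.map Γ'.bit tail) (hus : us.length < 3) :
    (readInstance : Prog Γ' Reg (d + 2)).eval w (fun _ => 0) .sec₃ = 0 := by
  set step : (Reg → ℕ) → Γ' → Reg → ℕ :=
    fun s a => (readStep a : Prog Γ' Reg (d + 1)).eval w s with hstep
  have hbits (u : List Bool) (r : List Γ') (s : Reg → ℕ) :
      ∃ s' : Reg → ℕ, s' .sec₁ = s .sec₁ ∧ s' .sec₂ = s .sec₂ ∧ s' .sec₃ = s .sec₃ ∧
        (u.map Γ'.bit ++ r).foldl step s = r.foldl step s' := by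
    induction u generalizing s with
    | nil => exact ⟨s, rfl, rfl, rfl, rfl⟩
    | cons b u ih =>
      obtain ⟨s', h1, h2, h3, h4⟩ := ih (step s (Γ'.bit b))
      have hkeep (y : Reg) (hy : y = .sec₁ ∨ y = .sec₂ ∨ y = .sec₃) :
          (readStep (Γ'.bit b) : Prog Γ' Reg (d + 1)).Keeps y := by
        obtain rfl | rfl | rfl := hy <;> cases b <;>
          simp [readStep, addBit, Keeps, copy, cap, double, move, clear, countdown]
      exact ⟨s', h1.trans ((hkeep .sec₁ (by simp)).eval_eq _ _),
        h2.trans ((hkeep .sec₂ (by simp)).eval_eq _ _),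
        h3.trans ((hkeep .sec₃ (by simp)).eval_eq _ _), h4⟩
  have hend : (endNumber : Prog Γ' Reg (d + 1)).Keeps .sec₃ := by
    simp [endNumber, Keeps, clear]
  rw [readInstance, eval_each]
  refine (congrFun (congrArg (List.foldl step _) hw) _).trans ?_
  match us, hus with
  | [], _ =>
    obtain ⟨s, -, -, h3, h4⟩ := hbits tail [] fun _ => 0
    rw [List.append_nil] at h4
    exact (congrFun h4 _).trans h3
  | [u], _ =>
    obtain ⟨s, h1, h2, h3, h4⟩ := hbits u (Γ'.comma :: List.map Γ'.bit tail) fun _ => 0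
    simp only [blocks_cons, blocks_nil, List.append_assoc, List.cons_append, List.nil_append]
    rw [h4, List.foldl_cons]
    obtain ⟨s', -, -, h7, h8⟩ := hbits tail [] (step s Γ'.comma)
    rw [List.append_nil] at h8
    rw [h8, List.foldl_nil, h7]
    simp [hstep, readStep, eval_ifz, h1, h3]
  | [u, u'], _ =>
    obtain ⟨s, h1, h2, h3, h4⟩ := hbits u (Γ'.comma :: (List.map Γ'.bit u' ++ Γ'.comma ::
      List.map Γ'.bit tail)) fun _ => 0
    simp only [blocks_cons, blocks_nil, List.append_assoc, List.cons_append, List.nil_append]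
    rw [h4, List.foldl_cons]
    obtain ⟨s', -, h6, h7, h8⟩ := hbits u' (Γ'.comma :: List.map Γ'.bit tail) (step s Γ'.comma)
    rw [h8, List.foldl_cons]
    have h6' : s' .sec₂ = 0 := by
      rw [h6]
      simp [hstep, readStep, eval_ifz, h1, h2]
    have h7' : s' .sec₃ = 0 := by
      rw [h7]
      simp [hstep, readStep, eval_ifz, h1, h3]
    obtain ⟨s'', -, -, h11, h12⟩ := hbits tail [] (step s' Γ'.comma)
    rw [List.append_nil] at h12
    rw [h12, List.foldl_nil, h11]
    by_cases h : s' .sec₁ = 0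
    · simp [hstep, readStep, eval_ifz, h, h7']
    · simp [hstep, readStep, eval_ifz, h, h6', hend.eval_eq, h7']

theorem exists_eq_blocks {w : List Γ'} (hw : ∀ a ∈ w, a = Γ'.comma ∨ ∃ b, a = Γ'.bit b) :
    ∃ us tail, w = blocks us ++ List.map Γ'.bit tail := by
  induction w with
  | nil => exact ⟨[], [], rfl⟩
  | cons a w ih =>
    rw [List.forall_mem_cons] at hw
    obtain ⟨us, tail, rfl⟩ := ih hw.2
    obtain rfl | ⟨b, rfl⟩ := hw.1
    · exact ⟨[] :: us, tail, by simp⟩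
    · cases us with
      | nil => exact ⟨[], b :: tail, by simp⟩
      | cons u us => exact ⟨(b :: u) :: us, tail, by simp⟩

theorem readStep_increases_bad (a : Γ') :
    (readStep a : Prog Γ' Reg (d + 1)).Increases .bad := by
  cases a with
  | bit b =>
    cases b <;> simp [readStep, addBit, Increases, copy, cap, double, move, clear, countdown]
  | comma => simp [readStep, endNumber, endVote, Increases, copy, subtract, move, clear, countdown]
  | _ => simp [readStep, Increases]

theorem eval_readInstance_bad {w : List Γ'} {a : Γ'} (ha : a ∈ w) (hcomma : a ≠ Γ'.comma)
    (hbit : ∀ b, a ≠ Γ'.bit b) :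
    (readInstance : Prog Γ' Reg (d + 2)).eval w (fun _ => 0) .bad ≠ 0 := by
  obtain ⟨l, r, rfl⟩ := List.append_of_mem ha
  have hinc (v : List Γ') (s : Reg → ℕ) : s .bad ≤ v.foldl (fun s a' =>
      (readStep a' : Prog Γ' Reg (d + 1)).eval (l ++ a :: r) s) s .bad := by
    induction v generalizing s with
    | nil => exact le_rfl
    | cons a' v ih => exact ((readStep_increases_bad a').le_eval _ s).trans (ih _)
  rw [readInstance, eval_each, List.foldl_append, List.foldl_cons]
  refine Nat.pos_iff_ne_zero.1 (lt_of_lt_of_le ?_ (hinc r _))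
  cases a with
  | comma => exact absurd rfl hcomma
  | bit b => exact absurd rfl (hbit b)
  | _ => simp [readStep]

/-- If no other symbols and at least three commas have been read, then the word starts with three
blocks of bits. -/
theorem exists_eq_blocks_of_sec₃ {w : List Γ'}
    (hbad : (readInstance : Prog Γ' Reg (d + 2)).eval w (fun _ => 0) .bad = 0)
    (hsec : (readInstance : Prog Γ' Reg (d + 2)).eval w (fun _ => 0) .sec₃ ≠ 0) :
    ∃ u₁ u₂ u₃ us tail, w = blocks (u₁ :: u₂ :: u₃ :: us) ++ List.map Γ'.bit tail := by
  have hw : ∀ a ∈ w, a = Γ'.comma ∨ ∃ b, a = Γ'.bit b := by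
    intro a ha
    by_contra! h
    exact eval_readInstance_bad ha h.1 h.2 hbad
  obtain ⟨us, tail, hw⟩ := exists_eq_blocks hw
  match us, hw with
  | [], hw | [_], hw | [_, _], hw => exact absurd (eval_readInstance_sec₃ hw (by simp)) hsec
  | u₁ :: u₂ :: u₃ :: us, hw => exact ⟨u₁, u₂, u₃, us, tail, hw⟩

/-- The words without an error in which the committee size is in bounds are the encodings of the
instances. -/
theorem exists_instance {N : ℕ} {u₁ u₂ u₃ : List Bool} {us : List (List Bool)} {tail : List Bool}
    (hN : u₁.count true ≤ N) (hbad : readResult N u₁ u₂ u₃ us tail .bad = 0)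
    (hcol : readResult N u₁ u₂ u₃ us tail .col = 0)
    (hsize : readResult N u₁ u₂ u₃ us tail .size ≠ 0)
    (hlt : readResult N u₁ u₂ u₃ us tail .size < readResult N u₁ u₂ u₃ us tail .cands) :
    ∃ I : Instance, I.encode = blocks (u₁ :: u₂ :: u₃ :: us) ++ List.map Γ'.bit tail := by
  simp only [readResult] at hbad hcol hsize hlt
  simp only [Nat.add_eq_zero_iff] at hbad
  obtain ⟨⟨⟨hbad₁, hbad₂⟩, hbad₃⟩, hbad₄⟩ := hbad
  have htail : tail = [] := List.length_eq_zero_iff.1 hcol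
  obtain ⟨k, rfl⟩ := exists_encodeNat_eq u₂ hbad₂
  obtain ⟨B, rfl⟩ := exists_encodeNat_eq u₃ hbad₃
  rw [bitsValue_encodeNat] at hsize hlt
  have hus : ∀ u ∈ us, u.length = u₁.count true := by
    intro u hu
    by_contra h
    have := List.sum_eq_zero_iff.1 hbad₄ _ (List.mem_map_of_mem hu)
    simp [h] at this
  have hk : 1 ≤ k ∧ k ≤ u₁.count true := by omega
  clear hsize hlt hN
  refine ⟨⟨u₁.count true, us.length, fun v => Finset.univ.filter fun c => us[v][c.val]? = some true,
    k, hk.1, hk.2, B⟩, ?_⟩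
  have hu₁ : List.replicate (u₁.count true) true = u₁ := by
    rw [eq_comm, List.eq_replicate_iff]
    refine ⟨?_, fun b hb => ?_⟩
    · have := List.count_true_add_count_false u₁
      omega
    · cases b with
      | true => rfl
      | false => exact absurd hb (List.count_eq_zero.1 hbad₁)
  subst htail
  rw [Instance.encode_eq_blocks, List.map_nil, List.append_nil]
  refine congrArg blocks ?_
  refine congrArg₂ _ hu₁ (congrArg₂ _ rfl (congrArg₂ _ rfl ?_))
  refine List.ext_getElem (by simp) fun v h1 h2 => ?_
  have h3 := hus us[v] (List.getElem_mem h2)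
  refine List.ext_getElem (by simp [voteBits, h3]) fun c h4 h5 => ?_
  simp [voteBits, h5]

end ApprovalVoting

namespace ApprovalVoting

open Computability LoopProgram LoopProgram.Prog

/-! ### The program: deciding the problem -/

variable {d : ℕ}

theorem numLevels_le {m n : ℕ} (E : Election m n) (x : ℕ) : numLevels E x ≤ n :=
  (Finset.card_filter_le _ _).trans (by simp)

/-- The counters after reading the encoding of an instance. The budget is cut off at the length of
the word, which does not affect the answer. -/
def Instance.start (I : Instance) : Reg → ℕ
  | .cands => I.m
  | .voters => I.n
  | .size => I.k
  | .budget => min I.B I.encode.length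
  | .sec₁ | .sec₂ | .sec₃ | .pow => 1
  | _ => 0

theorem Instance.eval_readInstance (I : Instance) :
    (readInstance : Prog Γ' Reg (d + 2)).eval I.encode (fun _ => 0) = I.start := by
  have hmN := I.m_lt_length
  have hkm := I.k_le_m
  rw [ApprovalVoting.eval_readInstance (tail := [])
    (I.encode_eq_blocks.trans (List.append_nil _).symm)]
  funext r
  cases r <;> simp [readResult, Instance.start, bitsValue_encodeNat, leadingZero_encodeNat]
  · omega
  · refine ⟨by simp [List.count_replicate], List.sum_eq_zero fun x hx => ?_⟩
    obtain ⟨v, rfl⟩ := List.mem_ofFn.1 hx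
    simp [voteBits]

/-- Sets `res` if the number of levels for `target` is at most the budget, or twice the budget. -/
def checkLevels (twice : Bool) : Prog Γ' Reg (d + 4) :=
  addLevels ;; subtract .budget .levels .tmp ;;
    (if twice then subtract .budget .levels .tmp else skip) ;; ifz .levels (inc .res) skip

/-- It does not matter that the budget has been cut off, since there are fewer levels than symbols
in the word. -/
theorem eval_checkLevels (twice : Bool) (I : Instance) {s : Reg → ℕ} {x : ℕ}
    (h : ∀ r, r ≠ .target → s r = if r = .mixed then s .mixed else I.start r)
    (hx : s .target = x) (hxm : x ≤ I.m) :
    (checkLevels twice : Prog Γ' Reg (d + 4)).eval I.encode s .res ≠ 0 ↔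
      numLevels I.E x ≤ (if twice then 2 else 1) * I.B := by
  have hmN := I.m_lt_length
  have hnN := I.n_lt_length
  have hL := numLevels_le I.E x
  have h0 (r : Reg) (hr : r ≠ .target) (hr' : r ≠ .mixed) : s r = I.start r := by
    rw [h r hr, if_neg hr']
  have hb : s .budget = min I.B I.encode.length := h0 _ (by decide) (by decide)
  have htmp : s .tmp = 0 := h0 _ (by decide) (by decide)
  have hlev : s .levels = 0 := h0 _ (by decide) (by decide)
  have hres : s .res = 0 := h0 _ (by decide) (by decide)
  rw [checkLevels, eval_seq, eval_addLevels I (h0 _ (by decide) (by decide))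
    (h0 _ (by decide) (by decide)) (by omega) (h0 _ (by decide) (by decide))
    (h0 _ (by decide) (by decide)) (h0 _ (by decide) (by decide)) (h0 _ (by decide) (by decide))
    (h0 _ (by decide) (by decide)) (h0 _ (by decide) (by decide)) (h0 _ (by decide) (by decide))
    (h0 _ (by decide) (by decide)), hx, hlev, Nat.zero_add, eval_seq,
    eval_subtract (by decide) (by decide) (by decide) (by simp [htmp]) (by simp [hb])]
  cases twice with
  | false =>
    simp only [eval_seq, eval_ifz, eval_skip, eval_inc, Bool.false_eq_true, if_false]
    split_ifs with h1 <;> simp [hb, hres] at h1 ⊢ <;> omega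
  | true =>
    rw [if_pos rfl, eval_seq, eval_subtract (by decide) (by decide) (by decide) (by simp [htmp])
      (by simp [hb])]
    simp only [eval_ifz, eval_skip, eval_inc, if_true]
    split_ifs with h1 <;> simp [hb, hres] at h1 ⊢ <;> omega

theorem eval_copy_seq {α R : Type} [DecidableEq R] {w : List α} {s : R → ℕ} {x y t : R} {a b : ℕ}
    (p : Prog α R (d + 1)) (hxy : x ≠ y) (hxt : x ≠ t) (hyt : y ≠ t) (ht : s t = 0)
    (hx : s x = a) (hy : s y = b) (ha : a ≤ w.length) :
    (copy x y t ;; p).eval w s = p.eval w (Function.update s y (b + a)) := by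
  rw [eval_seq, eval_copy hxy hxt hyt ht (hx ▸ ha), hx, hy]

theorem eval_subtract_seq {α R : Type} [DecidableEq R] {w : List α} {s : R → ℕ} {x y t : R}
    {a b : ℕ} (p : Prog α R (d + 1)) (hxy : x ≠ y) (hxt : x ≠ t) (hyt : y ≠ t) (ht : s t = 0)
    (hx : s x = a) (hy : s y = b) (ha : a ≤ w.length) :
    (subtract x y t ;; p).eval w s = p.eval w (Function.update s y (b - a)) := by
  rw [eval_seq, eval_subtract hxy hxt hyt ht (hx ▸ ha), hx, hy]

/-- The test for adding approvals: the target is the maximum of the committee size and the number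
of the candidates that are approved by all voters. -/
def testAdd : Prog Γ' Reg (d + 4) :=
  copy .voters .thr .tmp ;; addCount ;; clear .thr ;; subtract .size .count .tmp ;;
    copy .size .target .tmp ;; copy .count .target .tmp ;; clear .count ;;
    copy .cands .aux .tmp ;; subtract .target .aux .tmp ;;
    ifz .aux skip (clear .aux ;; checkLevels false)

theorem eval_testAdd (I : Instance) :
    (testAdd : Prog Γ' Reg (d + 4)).eval I.encode I.start .res ≠ 0 ↔
      max I.k (numAtLeast I.E I.n) < I.m ∧
        numLevels I.E (max I.k (numAtLeast I.E I.n)) ≤ I.B := by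
  have hmN := I.m_lt_length
  have hnN := I.n_lt_length
  have hkm := I.k_le_m
  have hc := numAtLeast_le I.E I.n
  have hmax : max I.k (numAtLeast I.E I.n) = I.k + (numAtLeast I.E I.n - I.k) := by omega
  rw [hmax, testAdd, eval_copy_seq (a := I.n) (b := 0) _ (by decide) (by decide) (by decide)
      (by rfl) (by rfl) (by rfl) (by omega),
    eval_seq, eval_addCount I (by rfl) (by simpa using hnN.le) (by rfl) (by rfl) (by rfl) (by rfl)
      (by rfl),
    eval_seq, eval_clear (x := Reg.thr) (by simpa using hnN.le),
    eval_subtract_seq (a := I.k) (b := numAtLeast I.E I.n) _ (by decide) (by decide) (by decide)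
      (by rfl) (by rfl) (by simp [Instance.start]) (by omega),
    eval_copy_seq (a := I.k) (b := 0) _ (by decide) (by decide) (by decide) (by rfl) (by rfl)
      (by rfl) (by omega),
    eval_copy_seq (a := numAtLeast I.E I.n - I.k) (b := I.k) _ (by decide) (by decide) (by decide)
      (by rfl) (by simp) (by simp) (by omega),
    eval_seq, eval_clear (x := Reg.count) (by simp; omega),
    eval_copy_seq (a := I.m) (b := 0) _ (by decide) (by decide) (by decide) (by rfl) (by rfl)
      (by rfl) (by omega),
    eval_subtract_seq (a := I.k + (numAtLeast I.E I.n - I.k)) (b := I.m) _ (by decide) (by decide)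
      (by decide) (by rfl) (by simp) (by simp) (by omega), eval_ifz]
  split_ifs with h
  · simp [Instance.start] at h ⊢
    omega
  · rw [eval_seq, eval_clear (x := Reg.aux) (by simp; omega),
      eval_checkLevels (x := I.k + (numAtLeast I.E I.n - I.k)) false I
        (by intro r hr; cases r <;> simp [Instance.start] at hr ⊢) (by simp) (by omega)]
    have h' : I.k + (numAtLeast I.E I.n - I.k) < I.m := by
      simp at h
      omega
    simp [h']

/-- The test for removing approvals: the target is the minimum of the committee size and the number
of the candidates that are approved by some voter. -/
def testRemove : Prog Γ' Reg (d + 4) :=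
  inc .thr ;; addCount ;; dec .thr ;; ifz .count skip
    (copy .size .target .tmp ;; copy .size .aux .tmp ;; subtract .count .aux .tmp ;;
      subtract .aux .target .tmp ;; clear .aux ;; clear .count ;; checkLevels false)

theorem eval_testRemove (I : Instance) :
    (testRemove : Prog Γ' Reg (d + 4)).eval I.encode I.start .res ≠ 0 ↔
      1 ≤ numAtLeast I.E 1 ∧ numLevels I.E (min I.k (numAtLeast I.E 1)) ≤ I.B := by
  have hmN := I.m_lt_length
  have hkm := I.k_le_m
  have hc := numAtLeast_le I.E 1
  have hmin : min I.k (numAtLeast I.E 1) = I.k - (I.k - numAtLeast I.E 1) := by omega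
  rw [hmin, testRemove, eval_seq, eval_inc, eval_seq,
    eval_addCount I (by rfl) (by simp [Instance.start]; omega) (by rfl) (by rfl) (by rfl) (by rfl)
      (by rfl),
    eval_seq, eval_dec, eval_ifz]
  split_ifs with h
  · simp [Instance.start] at h ⊢
    omega
  · rw [eval_copy_seq (a := I.k) (b := 0) _ (by decide) (by decide) (by decide) (by rfl) (by rfl)
      (by rfl) (by omega),
      eval_copy_seq (a := I.k) (b := 0) _ (by decide) (by decide) (by decide) (by rfl) (by rfl)
      (by rfl) (by omega),
      eval_subtract_seq (a := numAtLeast I.E 1) (b := I.k) _ (by decide) (by decide)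
        (by decide) (by rfl) (by simp [Instance.start]) (by simp) (by omega),
      eval_subtract_seq (a := I.k - numAtLeast I.E 1) (b := I.k) _ (by decide) (by decide)
        (by decide) (by rfl) (by simp) (by simp) (by omega),
      eval_seq, eval_clear (x := Reg.aux) (by simp; omega),
      eval_seq, eval_clear (x := Reg.count) (by simp [Instance.start]; omega),
      eval_checkLevels (x := I.k - (I.k - numAtLeast I.E 1)) false I
        (by intro r hr; cases r <;> simp [Instance.start] at hr ⊢) (by simp) (by omega)]
    simp [Instance.start] at h
    simp
    omega

/-- The test for swapping approvals: the target is the committee size. -/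
def testSwap : Prog Γ' Reg (d + 4) :=
  addMixed ;; ifz .mixed skip (copy .size .target .tmp ;; checkLevels true)

theorem eval_testSwap (I : Instance) :
    (testSwap : Prog Γ' Reg (d + 4)).eval I.encode I.start .res ≠ 0 ↔
      (∃ v, (∃ c, c ∈ I.E v) ∧ ∃ c, c ∉ I.E v) ∧ numLevels I.E I.k ≤ 2 * I.B := by
  have hmN := I.m_lt_length
  have hkm := I.k_le_m
  obtain ⟨x, hx, h⟩ := eval_addMixed (d := d + 2) I (s := I.start) rfl rfl rfl
  rw [testSwap, eval_seq, h, eval_ifz, ← hx]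
  split_ifs with h0
  · simp [Instance.start] at h0 ⊢
    simp [h0]
  · rw [eval_copy_seq (a := I.k) (b := 0) _ (by decide) (by decide) (by decide) (by rfl) (by rfl)
      (by rfl) (by omega), eval_checkLevels (x := I.k) true I
        (by intro r hr; cases r <;> simp [Instance.start] at hr ⊢) (by simp) (by omega)]
    simp [Instance.start] at h0
    simp [h0]

/-- The test of the conditions that are specific to a type of operations. -/
def test : Op → Prog Γ' Reg (d + 4)
  | .add => testAdd
  | .remove => testRemove
  | .swap => testSwap

/-- The program that decides the problem. The tests for particular operations are executed only if
the word has no error and the committee size and the budget are positive. If the committee size is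
not less than the number of candidates, then the result cannot be
changed, as there is at most one committee. -/
def decision (op : Op) : Prog Γ' Reg (d + 4) :=
  readInstance ;; ifz .bad (ifz .col (ifz .sec₃ skip (ifz .size skip (
    copy .cands .aux .tmp ;; subtract .size .aux .tmp ;; ifz .aux skip (clear .aux ;;
      ifz .budget skip (test op))))) skip) skip

/-- On the encodings of instances, the program gives the right answer. -/
theorem Instance.eval_decision (op : Op) (I : Instance) :
    (decision op : Prog Γ' Reg (d + 4)).eval I.encode (fun _ => 0) .res ≠ 0 ↔ I.IsYes AV op := by
  have hmN := I.m_lt_length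
  have hkm := I.k_le_m
  have hk := I.one_le_k
  have htest : (test op : Prog Γ' Reg (d + 4)).eval I.encode I.start .res ≠ 0 ∧
      1 ≤ I.B ∧ I.k < I.m ↔ I.IsYes AV op := by
    cases op with
    | add => rw [test, eval_testAdd, IsYes, add_radius_iff I.E hk hkm]; tauto
    | remove => rw [test, eval_testRemove, IsYes, remove_radius_iff I.E hk hkm]; tauto
    | swap => rw [test, eval_testSwap, IsYes, swap_radius_iff I.E hk hkm]; tauto
  rw [← htest, decision, eval_seq, I.eval_readInstance, eval_ifz,
    if_pos (show I.start .bad = 0 from rfl), eval_ifz, if_pos (show I.start .col = 0 from rfl),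
    eval_ifz, if_neg (by simp [start]), eval_ifz, if_neg (by simp [start]; omega),
    eval_copy_seq (a := I.m) (b := 0) _ (by decide) (by decide) (by decide) (by rfl) (by rfl)
      (by rfl) (by omega),
    eval_subtract_seq (a := I.k) (b := I.m) _ (by decide) (by decide) (by decide) (by rfl) (by rfl)
      (by simp) (by omega), eval_ifz]
  split_ifs with h
  · simp [start] at h ⊢
    omega
  · have hstart : Function.update (Function.update (Function.update I.start .aux (0 + I.m))
        .aux (I.m - I.k)) .aux 0 = I.start := by
      funext r
      cases r <;> simp [start]
    rw [eval_seq, eval_clear (x := Reg.aux) (by simp; omega), hstart, eval_ifz]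
    have hB : I.start .budget = min I.B I.encode.length := rfl
    split_ifs with h'
    · exact iff_of_false (by simp [start]) fun h1 => by omega
    · exact (and_iff_left (by simp at h; omega)).symm

/-- The program rejects the words that do not encode an instance. -/
theorem exists_instance_of_eval_decision {op : Op} {w : List Γ'}
    (h : (decision op : Prog Γ' Reg (d + 4)).eval w (fun _ => 0) .res ≠ 0) :
    ∃ I : Instance, I.encode = w := by
  have hkeep : (readInstance : Prog Γ' Reg (d + 4)).Keeps .res := by
    intro a
    cases a with
    | bit b =>
      cases b <;> simp [readStep, addBit, Keeps, copy, cap, double, move, clear, countdown]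
    | comma => simp [readStep, endNumber, endVote, Keeps, copy, subtract, move, clear, countdown]
    | _ => simp [readStep, Keeps]
  have hres := hkeep.eval_eq w fun _ => 0
  contrapose! h
  rw [decision, eval_seq, eval_ifz]
  split_ifs with hbad
  swap; · exact hres
  rw [eval_ifz]
  split_ifs with hcol
  swap; · exact hres
  rw [eval_ifz]
  split_ifs with hsec
  · exact hres
  rw [eval_ifz]
  split_ifs with hsize
  · exact hres
  obtain ⟨u₁, u₂, u₃, us, tail, hw⟩ := exists_eq_blocks_of_sec₃ (d := d + 2) hbad hsec
  have hN : u₁.count true ≤ w.length := by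
    have := u₁.count_le_length (a := true)
    simp [hw]; omega
  rw [eval_readInstance hw] at hbad hcol hsize ⊢
  rw [eval_copy_seq (a := u₁.count true) (b := 0) _ (by decide) (by decide) (by decide)
      (by rfl) (by rfl) (by rfl) hN,
    eval_subtract_seq (a := min (bitsValue u₂) w.length) (b := u₁.count true) _ (by decide)
      (by decide) (by decide) (by rfl) (by rfl) (by simp) (by simp), eval_ifz]
  split_ifs with h0
  · rfl
  · simp at h0
    obtain ⟨I, hI⟩ := exists_instance hN hbad hcol hsize (by simp [readResult]; omega)
    exact absurd (hI.trans hw.symm) (h I)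

end ApprovalVoting

theorem mainTheorem8 (op : ApprovalVoting.Op) :
    ApprovalVoting.InP (ApprovalVoting.robustnessRadius ApprovalVoting.AV op) := by
  refine LoopProgram.inP_of_prog (ApprovalVoting.decision (d := 0) op) .res
    fun w => ⟨?_, fun h => ?_⟩
  · rintro ⟨I, rfl, hI⟩
    exact (I.eval_decision op).2 hI
  · obtain ⟨I, rfl⟩ := ApprovalVoting.exists_instance_of_eval_decision h
    exact ⟨I, rfl, (I.eval_decision op).1 h⟩
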